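/- \textbf{Theorem (Deterministic phase transition).} For a set $E\subset\mathbb{C}$ let $\mathrm{Cap}(E)=\exp(-\inf_\mu I(\mu))$ be its logarithmic capacity, where $I(\mu)=\iint -\log|z-w|\,d\mu(z)\,d\mu(w)\in(-\infty,+\infty]$, the infimum is over the Borel probability measures $\mu$ whose support is a compact subset of $E$, and $e^{-\infty}=0$. Let $\lambda>0$ and let $(c_k)$ be a sequence in $(0,1)$. Put $\mathcal{A}_n=\{n,\dots,2n-1\}$ and $\mathcal{A}_{n,q}=\mathcal{A}_n\cup\mathcal{A}_{2n}\cup\dots\cup\mathcal{A}_{2^q n}$. Assume: (A.1) There is $\phi\in L^1([0,1],dx)$ with $\phi>0$ almost everywhere such that for every $f\in C([0,1])$, $$\frac1{\#\mathcal{A}_n}\sum_{k\in\mathcal{A}_n}f(c_k)\longrightarrow\int_0^1 f(x)\phi(x)\,dx\qquad(n\to\infty);$$ and there is a sequence of non-negative integers $q(n)\to\infty$ such that both of the following hold. (A.2) For every $\varepsilon>0$ there is $\delta>0$ such that for all sufficiently large $n$ and all $n',n''\in\{n,2n,\dots,2^{q(n)}n\}$, $$\frac{1}{\#(\mathcal{A}_{n'}\times\mathcal{A}_{n''})}\sum_{\substack{(i,j)\in\mathcal{A}_{n'}\times\mathcal{A}_{n''}\\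 i\ne j,\ |c_i-c_j|<\delta}}\bigl(-\log|c_i-c_j|\bigr)<\varepsilon .$$ (A.3) For every $\varepsilon>0$, for all sufficiently large $n$ and all $i\neq j$ in $\mathcal{A}_{n,q(n)}$, one has $c_i\ne c_j$ and $$\frac{e^{-\lambda i}+e^{-\lambda j}}{2|c_i-c_j|}<\varepsilon .$$ For $\alpha>0$ let $I_k^{\alpha}$ be the open interval with center $c_k$ and length $e^{-\lambda k^{\alpha}}$, and let $S_\alpha=\bigcap_m\bigcup_{k\ge m}I_k^{\alpha}$. Then (1) $\mathrm{Cap}(S_\alpha)=\mathrm{Cap}([0,1])>0$ for every $0<\alpha\le1$; (2) $\mathrm{Cap}(S_\alpha)=0$ for every $\alpha>1$. -/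

import Mathlib

open Filter Topology MeasureTheory Set

noncomputable section

/-- The logarithmic kernel `-log |z - w|` on the complex plane, with values in `[-∞, +∞]`
and equal to `+∞` on the diagonal. -/
def logKernel (z w : ℂ) : EReal := -ENNReal.log (edist z w)

/-- The interaction `I(ν, μ) = ∬ (-log |z - w|) dν(z) dμ(w)` of two positive measures: the integral
of the positive part of the kernel minus the integral of its negative part.
For finite measures with compact support the second integral is finite (the kernel is bounded
below there), so that no difference `∞ - ∞` occurs and the value lies in `(-∞, +∞]`. -/
def logInteraction (ν μ : Measure ℂ) : EReal :=
  ((∫⁻ w, ∫⁻ z, (logKernel z w).toENNReal ∂ν ∂μ : ENNReal) : EReal)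
    - ((∫⁻ w, ∫⁻ z, (-logKernel z w).toENNReal ∂ν ∂μ : ENNReal) : EReal)

/-- The logarithmic energy `I(μ) = I(μ, μ)`. -/
def logEnergy (μ : Measure ℂ) : EReal := logInteraction μ μ

/-- The Borel probability measures on `ℂ` whose (closed) support is a compact subset of `E`. -/
def compactlySupportedProbs (E : Set ℂ) : Set (Measure ℂ) :=
  {μ | IsProbabilityMeasure μ ∧ IsCompact μ.support ∧ μ.support ⊆ E}

/-- The logarithmic capacity `Cap(E) = exp (-inf I(μ))`, the infimum being over the Borel
probability measures whose support is a compact subset of `E`, with `exp (-∞) = 0`. -/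
def logCapacity (E : Set ℂ) : ENNReal :=
  EReal.exp (-(⨅ μ ∈ compactlySupportedProbs E, logEnergy μ))

/-- Capacity of a subset of the real line, seen as a subset of `ℂ`. -/
def realCapacity (E : Set ℝ) : ENNReal := logCapacity ((fun x : ℝ => (x : ℂ)) '' E)

/-- `S = ⋂ m, ⋃ k ≥ m, I_k`, where `I_k` is the open interval of center `c k` and length `l k`. -/
def limsupIntervals (c l : ℕ → ℝ) : Set ℝ :=
  ⋂ m : ℕ, ⋃ k ≥ m, Ioo (c k - l k / 2) (c k + l k / 2)

/-- The index block `A_n = {n, …, 2n - 1}`. -/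
def block (n : ℕ) : Finset ℕ := Finset.Ico n (2 * n)

/-- The index set `A_{n,q} = A_n ∪ A_{2n} ∪ ⋯ ∪ A_{2^q n}`. -/
def multiBlock (n q : ℕ) : Finset ℕ :=
  (Finset.range (q + 1)).biUnion fun s => block (2 ^ s * n)

/-- Distribution: the block averages of the centers converge weakly to `φ(x) dx` for an integrable
density `φ` on `[0,1]` that is positive almost everywhere. -/
def CentersDistributed (c : ℕ → ℝ) : Prop :=
  ∃ φ : ℝ → ℝ, IntegrableOn φ (Icc 0 1) ∧ (∀ᵐ x ∂(volume.restrict (Icc (0 : ℝ) 1)), 0 < φ x) ∧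
    ∀ f : ℝ → ℝ, ContinuousOn f (Icc 0 1) →
      Tendsto (fun n : ℕ => (∑ k ∈ block n, f (c k)) / ((block n).card : ℝ)) atTop
        (𝓝 (∫ x in Icc (0 : ℝ) 1, f x * φ x))

/-- Log-average spacing. Here `n'` and `n''` are `2 ^ s * n` and `2 ^ t * n` with `s, t ≤ q n`.
(The condition is only used together with `GapControl` for the same `q`; the latter makes all the
centers with indices in `A_{n,q(n)}` distinct for large `n`, so that `log 0` does not occur.) -/
def LogAverageSpacing (c : ℕ → ℝ) (q : ℕ → ℕ) : Prop :=
  ∀ ε > (0 : ℝ), ∃ δ > (0 : ℝ), ∀ᶠ n : ℕ in atTop, ∀ s ≤ q n, ∀ t ≤ q n,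
    (∑ p ∈ (block (2 ^ s * n) ×ˢ block (2 ^ t * n)) with
        (p.1 ≠ p.2 ∧ |c p.1 - c p.2| < δ), -Real.log |c p.1 - c p.2|)
      / ((block (2 ^ s * n) ×ˢ block (2 ^ t * n)).card : ℝ) < ε

/-- Gap control. Coinciding centers (an infinite quotient) violate the condition. -/
def GapControl (c l : ℕ → ℝ) (q : ℕ → ℕ) : Prop :=
  ∀ ε > (0 : ℝ), ∀ᶠ n : ℕ in atTop, ∀ i ∈ multiBlock n (q n), ∀ j ∈ multiBlock n (q n), i ≠ j →
    c i ≠ c j ∧ (l i + l j) / (2 * |c i - c j|) < ε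

end

open scoped ENNReal NNReal BoundedContinuousFunction

noncomputable section


/-! Everything happens on `[0, 1]`, where distances are at most 1 and the logarithmic kernel is
nonnegative. Energies can therefore be computed in `ℝ≥0∞` from the positive part alone.

Case `α > 1`. Suppose `ν` has finite energy and is carried by the limsup set. The intervals of index
at least `m` can be cut into disjoint pieces `D_k ⊆ I_k` that still carry all of `ν`. The square
`D_k × D_k` contributes at least `lam * k ^ α * ν(D_k) ^ 2` to the energy, so by Cauchy–Schwarz `1 =
∑ ν(D_k)` is bounded by the square root of the energy times that of the tail of `∑ 1 / (lam * k ^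
α)`. This series converges, a contradiction (`posEnergy_eq_top_of_limsupIntervals`).

Case `α ≤ 1`. By monotonicity `α = 1` suffices. A measure on `[0, 1]` of energy below `B` is first
smoothed (`exists_ac_posEnergy_lt`), so that it has a density with respect to `P = φ dx`. Then
`exists_next_measure` replaces it by a measure spread over small intervals around centers `c_k` with
`k ≥ m`, weighted by a continuous approximation of that density, keeping the energy below `B`. Away
from the diagonal the energy converges by equidistribution; close pairs of distinct centers are
negligible by log-average spacing; passing from points to intervals costs little by gap control. The
self-energies are the critical term: within a block `A_N` there are `N` of them, of size about `lam
* N` and weight `N⁻²`, a total that is bounded but not small. Averaging over the `q + 1` disjoint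
blocks `A_n, …, A_{2^q n}` divides this total by `q + 1`, and `q(n) → ∞`.

Iteration gives nested open sets carrying measures of energy below `B`. A weak limit lives on the
intersection of the closures, a compact subset of the limsup set, and lower semicontinuity bounds
its energy by `B` (`exists_limit_measure`). -/

/-! ### Logarithmic energy on the line and its relation to capacity in the plane -/

/-- The positive part of the logarithmic kernel. -/
def posLog {X : Type*} [PseudoEMetricSpace X] (x y : X) : ℝ≥0∞ := (-ENNReal.log (edist x y)).toENNReal

/-- The integral of the positive part of the logarithmic kernel. -/
def posEnergy {X : Type*} [PseudoEMetricSpace X] [MeasurableSpace X] (ν μ : Measure X) : ℝ≥0∞ :=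
  ∫⁻ y, ∫⁻ x, posLog x y ∂ν ∂μ

lemma continuous_posLog {X : Type*} [PseudoEMetricSpace X] :
    Continuous fun p : X × X => posLog p.1 p.2 := by
  unfold posLog
  apply EReal.continuous_toENNReal.comp
  apply continuous_neg.comp
  exact ENNReal.continuous_log.comp continuous_edist

lemma measurable_posLog : Measurable fun p : ℝ × ℝ => posLog p.1 p.2 :=
  continuous_posLog.measurable

lemma measurable_posLog_left (y : ℝ) : Measurable fun x : ℝ => posLog x y :=
  measurable_posLog.comp (measurable_id.prodMk measurable_const)

lemma posLog_comm {X : Type*} [PseudoEMetricSpace X] (x y : X) : posLog x y = posLog y x := by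
  simp [posLog, edist_comm]

lemma posLog_self {X : Type*} [PseudoEMetricSpace X] (x : X) : posLog x x = ⊤ := by
  simp [posLog]

lemma posLog_of_ne {x y : ℝ} (h : x ≠ y) : posLog x y = ENNReal.ofReal (-Real.log |x - y|) := by
  rw [posLog, edist_dist, Real.dist_eq, ENNReal.log_ofReal_of_pos (abs_pos.2 (sub_ne_zero.2 h)),
    ← EReal.coe_neg, EReal.real_coe_toENNReal]

lemma posLog_le {x y a : ℝ} (ha : 0 < a) (h : a ≤ |x - y|) :
    posLog x y ≤ ENNReal.ofReal (-Real.log a) := by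
  rw [posLog_of_ne (sub_ne_zero.1 (abs_pos.1 (ha.trans_le h)))]
  exact ENNReal.ofReal_le_ofReal (neg_le_neg (Real.log_le_log ha h))

lemma le_posLog {x y a : ℝ} (h : |x - y| ≤ a) :
    ENNReal.ofReal (-Real.log a) ≤ posLog x y := by
  rcases eq_or_ne x y with rfl | hxy
  · simp [posLog_self]
  rw [posLog_of_ne hxy]
  exact ENNReal.ofReal_le_ofReal (neg_le_neg (Real.log_le_log (abs_pos.2 (sub_ne_zero.2 hxy)) h))

lemma posEnergy_eq_prod (ν μ : Measure ℝ) [SFinite ν] [SFinite μ] :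
    posEnergy ν μ = ∫⁻ p, posLog p.1 p.2 ∂(μ.prod ν) := by
  rw [lintegral_prod _ measurable_posLog.aemeasurable, posEnergy]
  simp_rw [posLog_comm]

lemma posLog_ofReal (x y : ℝ) : posLog (x : ℂ) (y : ℂ) = posLog x y := by
  rw [posLog, posLog, edist_dist, edist_dist, Complex.isometry_ofReal.dist_eq]

/-- Two points of `[0, 1]` are at distance at most 1, so the negative part of the kernel vanishes
almost everywhere. -/
lemma logEnergy_map_ofReal (ν : Measure ℝ) [SFinite ν] (h : ν (Icc 0 1)ᶜ = 0) :
    logEnergy (ν.map ((↑) : ℝ → ℂ)) = (posEnergy ν ν : EReal) := by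
  have hm : MeasurableEmbedding ((↑) : ℝ → ℂ) :=
    Complex.isometry_ofReal.isClosedEmbedding.measurableEmbedding
  have key : ∀ F : ℂ → ℂ → ℝ≥0∞,
      ∫⁻ w, ∫⁻ z, F z w ∂(ν.map ((↑) : ℝ → ℂ)) ∂(ν.map ((↑) : ℝ → ℂ))
        = ∫⁻ y : ℝ, ∫⁻ x : ℝ, F x y ∂ν ∂ν := by
    intro F
    rw [hm.lintegral_map]
    exact lintegral_congr fun y => hm.lintegral_map _
  have hae : ∀ᵐ x ∂ν, x ∈ Icc (0 : ℝ) 1 := h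
  rw [logEnergy, logInteraction, key, key]
  have h0 : ∫⁻ y : ℝ, ∫⁻ x : ℝ, (-logKernel x y).toENNReal ∂ν ∂ν = 0 := by
    rw [lintegral_eq_zero_of_ae_eq_zero]
    filter_upwards [hae] with y hy
    refine lintegral_eq_zero_of_ae_eq_zero ?_
    filter_upwards [hae] with x hx
    rw [Pi.zero_apply, EReal.toENNReal_eq_zero_iff, logKernel, neg_neg, ENNReal.log_le_zero_iff,
      edist_dist, Complex.isometry_ofReal.dist_eq, Real.dist_eq]
    refine ENNReal.ofReal_le_one.2 (abs_le.2 ⟨?_, ?_⟩) <;> linarith [hx.1, hx.2, hy.1, hy.2]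
  rw [h0]
  have h1 : ∀ x y : ℝ, (logKernel x y).toENNReal = posLog x y := fun x y => posLog_ofReal x y
  simp_rw [h1]
  simp [posEnergy]

/-- A compactly supported probability measure on a set of real numbers is the image of a
probability measure on the line. -/
lemma exists_real_measure {E : Set ℝ} {μ : Measure ℂ}
    (hμ : μ ∈ compactlySupportedProbs ((fun x : ℝ => (x : ℂ)) '' E)) :
    ∃ ν : Measure ℝ, IsProbabilityMeasure ν ∧ ν Eᶜ = 0 ∧ μ = ν.map ((↑) : ℝ → ℂ) := by
  obtain ⟨hp, -, hE⟩ := hμ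
  have hae : ∀ᵐ z ∂μ, z ∈ (fun x : ℝ => (x : ℂ)) '' E :=
    mem_of_superset Measure.support_mem_ae hE
  have hre : Measurable Complex.re := Complex.measurable_re
  refine ⟨μ.map Complex.re, Measure.isProbabilityMeasure_map hre.aemeasurable, ?_, ?_⟩
  · have : ∀ᵐ x ∂(μ.map Complex.re), x ∈ E := by
      -- `E` need not be measurable, so the almost-everywhere statement is transported through the
      -- closed support.
      have hK : MeasurableSet (((↑) : ℝ → ℂ) ⁻¹' μ.support) :=
        Complex.measurable_ofReal Measure.isClosed_support.measurableSet
      have h1 : ∀ᵐ x ∂(μ.map Complex.re), x ∈ (((↑) : ℝ → ℂ) ⁻¹' μ.support) := by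
        refine (ae_map_iff hre.aemeasurable hK).2 ?_
        filter_upwards [Measure.support_mem_ae (μ := μ)] with z hz
        obtain ⟨x, -, rfl⟩ := hE hz
        simpa using hz
      filter_upwards [h1] with x hx
      obtain ⟨y, hy, hxy⟩ := hE hx
      exact Complex.ofReal_injective hxy ▸ hy
    exact this
  · rw [Measure.map_map Complex.measurable_ofReal hre]
    conv_lhs => rw [← Measure.map_id (μ := μ)]
    refine Measure.map_congr ?_
    filter_upwards [hae] with z hz
    obtain ⟨x, -, rfl⟩ := hz
    simp


lemma map_ofReal_mem_compactlySupportedProbs {E K : Set ℝ} (hK : IsCompact K) (hKE : K ⊆ E)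
    (ν : Measure ℝ) [IsProbabilityMeasure ν] (h : ν Kᶜ = 0) :
    ν.map ((↑) : ℝ → ℂ) ∈ compactlySupportedProbs ((fun x : ℝ => (x : ℂ)) '' E) := by
  have hm : Measurable ((↑) : ℝ → ℂ) := Complex.measurable_ofReal
  have hK' : IsCompact ((fun x : ℝ => (x : ℂ)) '' K) := hK.image Complex.continuous_ofReal
  have hs : (ν.map ((↑) : ℝ → ℂ)).support ⊆ (fun x : ℝ => (x : ℂ)) '' K := by
    refine Measure.support_subset_of_isClosed hK'.isClosed ?_
    refine (ae_map_iff hm.aemeasurable hK'.isClosed.measurableSet).2 ?_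
    have : ∀ᵐ x ∂ν, x ∈ K := h
    filter_upwards [this] with x hx using mem_image_of_mem _ hx
  exact ⟨Measure.isProbabilityMeasure_map hm.aemeasurable,
    hK'.of_isClosed_subset Measure.isClosed_support hs, hs.trans (image_mono hKE)⟩

lemma logCapacity_mono {E F : Set ℂ} (h : E ⊆ F) : logCapacity E ≤ logCapacity F := by
  refine EReal.exp_monotone (EReal.neg_le_neg_iff.2 ?_)
  exact biInf_mono fun μ hμ => ⟨hμ.1, hμ.2.1, hμ.2.2.trans h⟩

/-- If every finite-energy measure on `F` can be moved to a compact subset of `E` at an arbitrarily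
small cost of energy, then the capacity of `F` is at most that of `E`. -/
lemma realCapacity_le_of_energy {E F : Set ℝ} (hF : F ⊆ Icc 0 1) (hE : E ⊆ Icc 0 1)
    (h : ∀ ν : Measure ℝ, IsProbabilityMeasure ν → ν Fᶜ = 0 → ∀ B : ℝ≥0∞, B ≠ ⊤ →
      posEnergy ν ν < B → ∃ K ⊆ E, IsCompact K ∧ ∃ ν' : Measure ℝ, IsProbabilityMeasure ν' ∧
        ν' Kᶜ = 0 ∧ posEnergy ν' ν' ≤ B) :
    realCapacity F ≤ realCapacity E := by
  refine EReal.exp_monotone (EReal.neg_le_neg_iff.2 (le_iInf₂ fun μ hμ => ?_))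
  obtain ⟨ν, hν, hνF, rfl⟩ := exists_real_measure hμ
  rw [logEnergy_map_ofReal ν (measure_mono_null (compl_subset_compl.2 hF) hνF)]
  refine le_of_forall_gt fun b hb => ?_
  obtain ⟨r, hr1, hr2⟩ := EReal.lt_iff_exists_real_btwn.1 hb
  have hr0 : (0 : ℝ) ≤ r := by
    have : (0 : EReal) ≤ r := (EReal.coe_ennreal_nonneg _).trans hr1.le
    exact_mod_cast this
  have hr : ((ENNReal.ofReal r : ℝ≥0∞) : EReal) = r := by
    rw [EReal.coe_ennreal_ofReal, max_eq_left hr0]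
  rw [← hr, EReal.coe_ennreal_lt_coe_ennreal_iff] at hr1
  obtain ⟨K, hKE, hK, ν', hν', hν'K, hν'B⟩ := h ν hν hνF _ ENNReal.ofReal_ne_top hr1
  refine lt_of_le_of_lt (iInf₂_le _ (map_ofReal_mem_compactlySupportedProbs hK hKE ν' hν'K)) ?_
  rw [logEnergy_map_ofReal ν' (measure_mono_null (compl_subset_compl.2 (hKE.trans hE)) hν'K)]
  refine lt_of_le_of_lt ?_ hr2
  rw [← hr]
  exact_mod_cast hν'B

lemma realCapacity_eq_zero_of_energy {E : Set ℝ} (hE : E ⊆ Icc 0 1)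
    (h : ∀ ν : Measure ℝ, IsProbabilityMeasure ν → ν Eᶜ = 0 → posEnergy ν ν = ⊤) :
    realCapacity E = 0 := by
  have : (⨅ μ ∈ compactlySupportedProbs ((fun x : ℝ => (x : ℂ)) '' E), logEnergy μ) = ⊤ := by
    refine top_le_iff.1 (le_iInf₂ fun μ hμ => ?_)
    obtain ⟨ν, hν, hνE, rfl⟩ := exists_real_measure hμ
    rw [logEnergy_map_ofReal ν (measure_mono_null (compl_subset_compl.2 hE) hνE), h ν hν hνE]
    simp
  rw [realCapacity, logCapacity, this]
  simp

lemma realCapacity_pos_of_energy {E K : Set ℝ} (hE : E ⊆ Icc 0 1) (hKE : K ⊆ E)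
    (hK : IsCompact K) (ν : Measure ℝ) [IsProbabilityMeasure ν] (hν : ν Kᶜ = 0)
    (h : posEnergy ν ν ≠ ⊤) : 0 < realCapacity E := by
  rw [realCapacity, logCapacity, pos_iff_ne_zero, Ne, EReal.exp_eq_zero_iff, EReal.neg_eq_bot_iff]
  intro htop
  have := htop ▸ iInf₂_le (f := fun μ _ => logEnergy μ) _
    (map_ofReal_mem_compactlySupportedProbs hK hKE ν hν)
  rw [logEnergy_map_ofReal ν (measure_mono_null (compl_subset_compl.2 (hKE.trans hE)) hν),
    top_le_iff] at this
  exact h (EReal.coe_ennreal_eq_top_iff.1 this)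


/-! ### Limsup sets of intervals and zero capacity above the critical exponent -/

lemma limsupIntervals_subset_Icc {c l : ℕ → ℝ} (hc : ∀ k, c k ∈ Ioo (0 : ℝ) 1)
    (hl : Tendsto l atTop (𝓝 0)) : limsupIntervals c l ⊆ Icc 0 1 := by
  intro x hx
  simp only [limsupIntervals, mem_iInter, mem_iUnion, exists_prop] at hx
  have key : ∀ ε > 0, -ε ≤ x ∧ x ≤ 1 + ε := by
    intro ε hε
    obtain ⟨m, hm⟩ := (hl.eventually (gt_mem_nhds hε)).exists_forall_of_atTop
    obtain ⟨k, hk, h1, h2⟩ := hx m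
    have := hm k hk
    have := hc k
    constructor <;> linarith [this.1, this.2]
  refine ⟨le_of_forall_pos_le_add fun ε hε => by linarith [key ε hε],
    le_of_forall_pos_le_add fun ε hε => (key ε hε).2⟩

lemma limsupIntervals_mono {c l l' : ℕ → ℝ} (h : ∀ k ≥ 1, l k ≤ l' k) :
    limsupIntervals c l ⊆ limsupIntervals c l' := by
  intro x hx
  simp only [limsupIntervals, mem_iInter, mem_iUnion, exists_prop] at hx ⊢
  intro m
  obtain ⟨k, hk, h1, h2⟩ := hx (max m 1)
  have := h k (le_trans (le_max_right _ _) hk)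
  exact ⟨k, le_trans (le_max_left _ _) hk, by linarith, by linarith⟩

lemma tendsto_exp_neg_mul_rpow {lam α : ℝ} (hlam : 0 < lam) (hα : 0 < α) :
    Tendsto (fun k : ℕ => Real.exp (-lam * (k : ℝ) ^ α)) atTop (𝓝 0) := by
  refine Real.tendsto_exp_atBot.comp ?_
  exact ((tendsto_rpow_atTop hα).comp tendsto_natCast_atTop_atTop).const_mul_atTop_of_neg
    (neg_neg_of_pos hlam)

/-- Additive form of Cauchy–Schwarz: summed over pieces of mass `a`, it bounds the total mass by the
energy and the sum of the `b⁻¹`, with `t` free to balance the two. It follows from `0 ≤ (t * b * a -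
1) ^ 2`. -/
lemma le_mul_sq_mul_add_inv {a : ℝ≥0∞} (ha : a ≠ ⊤) {t b : ℝ} (ht : 0 < t) (hb : 0 < b) :
    a ≤ ENNReal.ofReal t * (ENNReal.ofReal b * a * a) + ENNReal.ofReal t⁻¹ * ENNReal.ofReal b⁻¹ := by
  obtain ⟨r, hr, rfl⟩ : ∃ r : ℝ, 0 ≤ r ∧ a = ENNReal.ofReal r :=
    ⟨a.toReal, ENNReal.toReal_nonneg, (ENNReal.ofReal_toReal ha).symm⟩
  rw [← ENNReal.ofReal_mul hb.le, ← ENNReal.ofReal_mul (by positivity),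
    ← ENNReal.ofReal_mul (by positivity), ← ENNReal.ofReal_mul (by positivity),
    ← ENNReal.ofReal_add (by positivity) (by positivity)]
  refine ENNReal.ofReal_le_ofReal ?_
  have h := sq_nonneg (t * b * r - 1)
  have : t * (b * r * r) + t⁻¹ * b⁻¹ - r = ((t * b * r - 1) ^ 2 + t * b * r) / (t * b) := by
    field_simp
    ring
  have : 0 ≤ t * (b * r * r) + t⁻¹ * b⁻¹ - r := by rw [this]; positivity
  linarith

/-- A measure of finite energy does not charge a limsup set of intervals `I_k` such that
`∑ 1 / log (1 / |I_k|)` converges. -/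
lemma posEnergy_eq_top_of_limsupIntervals {c b : ℕ → ℝ} (hb : ∀ k ≥ 1, 0 < b k)
    (hsum : Summable fun k => (b k)⁻¹) (ν : Measure ℝ) [IsProbabilityMeasure ν]
    (hν : ν (limsupIntervals c fun k => Real.exp (-b k))ᶜ = 0) : posEnergy ν ν = ⊤ := by
  by_contra hfin
  obtain ⟨e, he, hee⟩ : ∃ e : ℝ, 0 ≤ e ∧ posEnergy ν ν = ENNReal.ofReal e :=
    ⟨_, ENNReal.toReal_nonneg, (ENNReal.ofReal_toReal hfin).symm⟩
  -- This makes `t * e ≤ 1 / 2`; the `+ 1` covers `e = 0`. The tail from `m` on is then chosen so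
  -- that the other term is below `1 / 2`.
  set t : ℝ := (2 * (e + 1))⁻¹ with ht
  have ht0 : 0 < t := by positivity
  have hlim := ENNReal.tendsto_sum_nat_add (fun k => ENNReal.ofReal (b k)⁻¹) hsum.tsum_ofReal_ne_top
  have hlim2 := ENNReal.Tendsto.const_mul (a := ENNReal.ofReal t⁻¹) hlim
    (Or.inr ENNReal.ofReal_ne_top)
  rw [mul_zero] at hlim2
  obtain ⟨m, hm, hm1⟩ := ((hlim2.eventually (gt_mem_nhds
    (show (0 : ℝ≥0∞) < ENNReal.ofReal (1 / 2) by simp))).and (eventually_ge_atTop 1)).exists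
  set I : ℕ → Set ℝ := fun k => Ioo (c (k + m) - Real.exp (-b (k + m)) / 2)
    (c (k + m) + Real.exp (-b (k + m)) / 2) with hI
  have hImeas : ∀ k, MeasurableSet (I k) := fun k => measurableSet_Ioo
  have hJmeas : ∀ k, MeasurableSet (disjointed I k) := fun k => .disjointed hImeas k
  have hone : ∑' k, ν (disjointed I k) = 1 := by
    rw [← measure_iUnion (disjoint_disjointed I) hJmeas, iUnion_disjointed]
    refine (prob_compl_eq_zero_iff (MeasurableSet.iUnion hImeas)).1
      (measure_mono_null (compl_subset_compl.2 ?_) hν)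
    intro x hx
    simp only [limsupIntervals, mem_iInter, mem_iUnion, exists_prop] at hx ⊢
    obtain ⟨k, hk, hxk⟩ := hx m
    exact ⟨k - m, by simpa [hI, Nat.sub_add_cancel hk] using hxk⟩
  -- The squares of the disjointed pieces are disjoint subsets of the plane, and on each of them the
  -- kernel is at least `b (k + m)`.
  have henergy : ∑' k, ENNReal.ofReal (b (k + m)) * ν (disjointed I k) * ν (disjointed I k)
      ≤ posEnergy ν ν := by
    calc _ ≤ ∑' k, ∫⁻ y in disjointed I k, ∫⁻ x, posLog x y ∂ν ∂ν := by
          refine ENNReal.tsum_le_tsum fun k => ?_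
          calc _ = ∫⁻ _ in disjointed I k, ENNReal.ofReal (b (k + m)) * ν (disjointed I k) ∂ν := by
                rw [setLIntegral_const]
            _ ≤ _ := by
                refine setLIntegral_mono' (hJmeas k) fun y hy => ?_
                calc _ = ∫⁻ _ in disjointed I k, ENNReal.ofReal (b (k + m)) ∂ν := by
                      rw [setLIntegral_const]
                  _ ≤ ∫⁻ x in disjointed I k, posLog x y ∂ν := by
                      refine setLIntegral_mono' (hJmeas k) fun x hx => ?_
                      have hx' := disjointed_le I k hx
                      have hy' := disjointed_le I k hy
                      have : |x - y| ≤ Real.exp (-b (k + m)) :=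
                        abs_le.2 ⟨by linarith [hx'.1, hy'.2], by linarith [hx'.2, hy'.1]⟩
                      simpa using le_posLog this
                  _ ≤ _ := setLIntegral_le_lintegral _ _
      _ = ∫⁻ y in ⋃ k, disjointed I k, ∫⁻ x, posLog x y ∂ν ∂ν :=
          (lintegral_iUnion hJmeas (disjoint_disjointed I) _).symm
      _ ≤ _ := setLIntegral_le_lintegral _ _
  have hfinal : (1 : ℝ≥0∞) ≤ ENNReal.ofReal t * posEnergy ν ν
      + ENNReal.ofReal t⁻¹ * ∑' k, ENNReal.ofReal (b (k + m))⁻¹ := by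
    calc (1 : ℝ≥0∞) = ∑' k, ν (disjointed I k) := hone.symm
      _ ≤ ∑' k, (ENNReal.ofReal t * (ENNReal.ofReal (b (k + m)) * ν (disjointed I k)
            * ν (disjointed I k)) + ENNReal.ofReal t⁻¹ * ENNReal.ofReal (b (k + m))⁻¹) :=
          ENNReal.tsum_le_tsum fun k =>
            le_mul_sq_mul_add_inv (measure_ne_top _ _) ht0 (hb _ (by omega))
      _ ≤ _ := by
          rw [ENNReal.tsum_add, ENNReal.tsum_mul_left, ENNReal.tsum_mul_left]
          gcongr
  have hsmall : ENNReal.ofReal t * posEnergy ν ν ≤ ENNReal.ofReal (1 / 2) := by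
    rw [hee, ← ENNReal.ofReal_mul ht0.le]
    refine ENNReal.ofReal_le_ofReal ?_
    rw [ht, inv_mul_le_iff₀ (by positivity)]
    linarith
  have := hfinal.trans_lt (ENNReal.add_lt_add_of_le_of_lt
    (ENNReal.mul_ne_top ENNReal.ofReal_ne_top hfin) hsmall hm)
  rw [← ENNReal.ofReal_add (by norm_num) (by norm_num)] at this
  norm_num at this

lemma realCapacity_limsupIntervals_eq_zero {c : ℕ → ℝ} (hc : ∀ k, c k ∈ Ioo (0 : ℝ) 1)
    {lam α : ℝ} (hlam : 0 < lam) (hα : 1 < α) :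
    realCapacity (limsupIntervals c fun k => Real.exp (-lam * (k : ℝ) ^ α)) = 0 := by
  refine realCapacity_eq_zero_of_energy
    (limsupIntervals_subset_Icc hc (tendsto_exp_neg_mul_rpow hlam (by linarith))) ?_
  intro ν _ h
  refine posEnergy_eq_top_of_limsupIntervals (c := c) (b := fun k => lam * (k : ℝ) ^ α) ?_ ?_ ν ?_
  · intro k hk
    have : (0 : ℝ) < k := by exact_mod_cast hk
    positivity
  · simp_rw [mul_inv]
    exact (Real.summable_nat_rpow_inv.2 hα).mul_left _
  · simpa only [neg_mul] using h


/-! ### Potentials of intervals, and regularisation of a measure on `[0, 1]` -/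

/-- `Real.log` is even, so the integrand is `log (ℓ / |x - y|)`, which is nonnegative on the
interval and has an explicit primitive. -/
lemma lintegral_log_div_abs_sub (y : ℝ) {ℓ : ℝ} (hℓ : 0 < ℓ) :
    ∫⁻ x in Ioo (y - ℓ) (y + ℓ), ENNReal.ofReal (Real.log ℓ - Real.log (x - y))
      = ENNReal.ofReal (2 * ℓ) := by
  have hint : IntervalIntegrable (fun x => Real.log ℓ - Real.log (x - y)) volume (y - ℓ) (y + ℓ) := by
    refine intervalIntegrable_const.sub ?_
    have := (intervalIntegral.intervalIntegrable_log' (a := -ℓ) (b := ℓ)).comp_sub_right y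
    simpa [add_comm, sub_eq_add_neg] using this
  have hle : y - ℓ ≤ y + ℓ := by linarith
  have hint' : IntegrableOn (fun x => Real.log ℓ - Real.log (x - y)) (Ioo (y - ℓ) (y + ℓ)) :=
    ((intervalIntegrable_iff_integrableOn_Ioc_of_le hle).1 hint).mono_set Ioo_subset_Ioc_self
  rw [← ofReal_integral_eq_lintegral_ofReal hint']
  · rw [← integral_Ioc_eq_integral_Ioo, ← intervalIntegral.integral_of_le hle,
      intervalIntegral.integral_comp_sub_right (fun x => Real.log ℓ - Real.log x) y,
      intervalIntegral.integral_sub intervalIntegrable_const intervalIntegral.intervalIntegrable_log',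
      integral_log, intervalIntegral.integral_const]
    congr 1
    have : y - ℓ - y = -ℓ := by ring
    rw [this, Real.log_neg_eq_log]
    simp
    ring
  · have hne : ∀ᵐ x : ℝ ∂volume.restrict (Ioo (y - ℓ) (y + ℓ)), x ≠ y := by
      refine ae_restrict_of_ae ?_
      simp [ae_iff]
    filter_upwards [ae_restrict_mem measurableSet_Ioo, hne] with x hx hxy
    have h1 : |x - y| ≤ ℓ := abs_le.2 ⟨by linarith [hx.1], by linarith [hx.2]⟩
    have := Real.log_le_log (abs_pos.2 (sub_ne_zero.2 hxy)) h1
    rw [Real.log_abs] at this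
    simpa using this

/-- The logarithmic potential of normalised length on an interval of length `ℓ ≤ 1`. -/
lemma lintegral_posLog_Ioo_le (a y : ℝ) {ℓ : ℝ} (hℓ : 0 < ℓ) (hℓ1 : ℓ ≤ 1) :
    ENNReal.ofReal ℓ⁻¹ * ∫⁻ x in Ioo a (a + ℓ), posLog x y ≤ ENNReal.ofReal (-Real.log ℓ + 2) := by
  have hlog : 0 ≤ -Real.log ℓ := neg_nonneg.2 (Real.log_nonpos hℓ.le hℓ1)
  -- `F` is the excess of the kernel over `-log ℓ`. It lives within distance `ℓ` of `y`, so its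
  -- integral over any set is at most `2 * ℓ`.
  set F : ℝ → ℝ≥0∞ := (Ioo (y - ℓ) (y + ℓ)).indicator
    fun x => ENNReal.ofReal (Real.log ℓ - Real.log (x - y)) with hF
  have hne : ∀ᵐ x : ℝ ∂volume.restrict (Ioo a (a + ℓ)), x ≠ y := by
    refine ae_restrict_of_ae ?_
    simp [ae_iff]
  have h1 : ∫⁻ x in Ioo a (a + ℓ), posLog x y
      ≤ ∫⁻ x in Ioo a (a + ℓ), (ENNReal.ofReal (-Real.log ℓ) + F x) := by
    refine lintegral_mono_ae ?_
    filter_upwards [hne] with x hxy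
    by_cases hx : x ∈ Ioo (y - ℓ) (y + ℓ)
    · rw [hF, indicator_of_mem hx]
      refine le_trans ?_ ENNReal.ofReal_add_le
      rw [posLog_of_ne hxy, Real.log_abs]
      exact ENNReal.ofReal_le_ofReal (by linarith)
    · refine (posLog_le hℓ ?_).trans le_self_add
      by_contra! h
      exact hx ⟨by linarith [(abs_lt.1 h).1], by linarith [(abs_lt.1 h).2]⟩
  have h2 : ∫⁻ x in Ioo a (a + ℓ), F x ≤ ENNReal.ofReal (2 * ℓ) := by
    rw [← lintegral_log_div_abs_sub y hℓ,
      ← lintegral_indicator (f := fun x => ENNReal.ofReal (Real.log ℓ - Real.log (x - y)))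
        measurableSet_Ioo]
    exact setLIntegral_le_lintegral _ _
  calc _ ≤ ENNReal.ofReal ℓ⁻¹ * (ENNReal.ofReal (-Real.log ℓ) * ENNReal.ofReal ℓ
        + ENNReal.ofReal (2 * ℓ)) := by
        gcongr
        refine h1.trans ?_
        rw [lintegral_add_left measurable_const, setLIntegral_const, Real.volume_Ioo]
        gcongr
        linarith
    _ = _ := by
        rw [← ENNReal.ofReal_mul hlog, ← ENNReal.ofReal_add (by positivity) (by positivity),
          ← ENNReal.ofReal_mul (by positivity)]
        congr 1
        field_simp

lemma realCapacity_Icc_pos : 0 < realCapacity (Icc 0 1) := by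
  have : IsProbabilityMeasure (volume.restrict (Icc (0 : ℝ) 1)) := ⟨by simp⟩
  refine realCapacity_pos_of_energy subset_rfl subset_rfl isCompact_Icc
    (volume.restrict (Icc (0 : ℝ) 1)) (by simp [Measure.restrict_apply measurableSet_Icc.compl]) ?_
  refine ne_top_of_le_ne_top (b := ENNReal.ofReal 2) ENNReal.ofReal_ne_top ?_
  calc _ ≤ ∫⁻ _ in Icc (0 : ℝ) 1, ENNReal.ofReal 2 := by
        refine lintegral_mono fun y => ?_
        have := lintegral_posLog_Ioo_le 0 y one_pos le_rfl
        rw [restrict_Ioo_eq_restrict_Icc] at this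
        simpa using this
    _ = _ := by simp

/-- The law of `(1 - η) X + η U`, for independent `X` of law `ν` and `U` uniform on `(0, 1)`. -/
def contractAndSmooth (ν : Measure ℝ) (η : ℝ) : Measure ℝ :=
  volume.withDensity fun s => ∫⁻ x, ENNReal.ofReal η⁻¹ *
    ({p : ℝ × ℝ | (1 - η) * p.1 < p.2 ∧ p.2 < (1 - η) * p.1 + η}.indicator 1 (x, s)) ∂ν

lemma lintegral_contractAndSmooth (ν : Measure ℝ) [SFinite ν] (η : ℝ) {F : ℝ → ℝ≥0∞}
    (hF : Measurable F) :
    ∫⁻ s, F s ∂(contractAndSmooth ν η) = ∫⁻ x, (ENNReal.ofReal η⁻¹ *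
      ∫⁻ s in Ioo ((1 - η) * x) ((1 - η) * x + η), F s) ∂ν := by
  have hS : MeasurableSet {p : ℝ × ℝ | (1 - η) * p.1 < p.2 ∧ p.2 < (1 - η) * p.1 + η} := by
    have h1 : MeasurableSet {p : ℝ × ℝ | (1 - η) * p.1 < p.2} :=
      measurableSet_lt (by fun_prop) (by fun_prop)
    have h2 : MeasurableSet {p : ℝ × ℝ | p.2 < (1 - η) * p.1 + η} :=
      measurableSet_lt (by fun_prop) (by fun_prop)
    exact (h1.inter h2).congr (Set.ext fun _ => Iff.rfl)
  have hk : Measurable fun p : ℝ × ℝ => ENNReal.ofReal η⁻¹ *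
      ({p : ℝ × ℝ | (1 - η) * p.1 < p.2 ∧ p.2 < (1 - η) * p.1 + η}.indicator
        (1 : ℝ × ℝ → ℝ≥0∞) p) :=
    (measurable_one.indicator hS).const_mul _
  have hd : Measurable fun s : ℝ => ∫⁻ x, ENNReal.ofReal η⁻¹ *
      ({p : ℝ × ℝ | (1 - η) * p.1 < p.2 ∧ p.2 < (1 - η) * p.1 + η}.indicator
        (1 : ℝ × ℝ → ℝ≥0∞) (x, s)) ∂ν := hk.lintegral_prod_left'
  rw [contractAndSmooth, lintegral_withDensity_eq_lintegral_mul _ hd hF]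
  simp only [Pi.mul_apply]
  calc _ = ∫⁻ s : ℝ, (∫⁻ x, ENNReal.ofReal η⁻¹ *
        ({p : ℝ × ℝ | (1 - η) * p.1 < p.2 ∧ p.2 < (1 - η) * p.1 + η}.indicator 1 (x, s)) * F s ∂ν) := by
        refine lintegral_congr fun s => ?_
        rw [lintegral_mul_const]
        exact hk.comp (measurable_id.prodMk measurable_const)
    _ = ∫⁻ x, (∫⁻ s : ℝ, ENNReal.ofReal η⁻¹ *
        ({p : ℝ × ℝ | (1 - η) * p.1 < p.2 ∧ p.2 < (1 - η) * p.1 + η}.indicator 1 (x, s)) * F s) ∂ν := by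
        refine lintegral_lintegral_swap ?_
        exact ((hk.comp measurable_swap).mul (hF.comp measurable_fst)).aemeasurable
    _ = _ := by
        refine lintegral_congr fun x => ?_
        rw [← lintegral_indicator measurableSet_Ioo, ← lintegral_const_mul _ (hF.indicator measurableSet_Ioo)]
        refine lintegral_congr fun s => ?_
        by_cases h : (1 - η) * x < s ∧ s < (1 - η) * x + η
        · rw [indicator_of_mem (show (x, s) ∈ {p : ℝ × ℝ | (1 - η) * p.1 < p.2 ∧
            p.2 < (1 - η) * p.1 + η} from h), indicator_of_mem (show s ∈ Ioo _ _ from h)]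
          simp
        · rw [indicator_of_notMem (show (x, s) ∉ {p : ℝ × ℝ | (1 - η) * p.1 < p.2 ∧
            p.2 < (1 - η) * p.1 + η} from h), indicator_of_notMem (show s ∉ Ioo _ _ from h)]
          simp

lemma ofReal_inv_mul_lintegral_const (a : ℝ) {η : ℝ} (hη : 0 < η) (C : ℝ≥0∞) :
    ENNReal.ofReal η⁻¹ * ∫⁻ _ in Ioo a (a + η), C = C := by
  rw [setLIntegral_const, Real.volume_Ioo, add_sub_cancel_left, mul_comm C, ← mul_assoc,
    ← ENNReal.ofReal_mul (by positivity), inv_mul_cancel₀ hη.ne']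
  simp

/-- An upper bound for the smoothed kernel. -/
def smoothKernelBound (η x y : ℝ) : ℝ≥0∞ :=
  if 4 * η ≤ |x - y| then ENNReal.ofReal (-Real.log ((1 - η) * |x - y| - η))
    else ENNReal.ofReal (-Real.log η + 2)

lemma measurable_smoothKernelBound (η : ℝ) :
    Measurable fun p : ℝ × ℝ => smoothKernelBound η p.1 p.2 := by
  unfold smoothKernelBound
  refine Measurable.ite (measurableSet_le measurable_const (by fun_prop)) ?_ measurable_const
  fun_prop

/-- If `x` and `y` are far apart, contraction and smoothing leave a distance of at least `(1 - η) *
|x - y| - η`. If they are close, the potential of a uniform law on an interval of length `η` is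
bounded by `-log η + 2` everywhere. -/
lemma posEnergy_contractAndSmooth_le (ν : Measure ℝ) [SFinite ν] {η : ℝ} (hη : 0 < η)
    (hη2 : η ≤ 1 / 2) :
    posEnergy (contractAndSmooth ν η) (contractAndSmooth ν η)
      ≤ ∫⁻ y, ∫⁻ x, smoothKernelBound η x y ∂ν ∂ν := by
  have hm : Measurable fun t : ℝ => ∫⁻ s, posLog s t ∂(contractAndSmooth ν η) := by
    have : SFinite (contractAndSmooth ν η) := by unfold contractAndSmooth; infer_instance
    exact measurable_posLog.lintegral_prod_left'
  rw [posEnergy, lintegral_contractAndSmooth ν η hm]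
  refine lintegral_mono fun y => ?_
  refine le_trans ?_ (ofReal_inv_mul_lintegral_const ((1 - η) * y) hη _).le
  refine mul_le_mul' le_rfl ?_
  refine setLIntegral_mono' measurableSet_Ioo fun t ht => ?_
  rw [lintegral_contractAndSmooth ν η (measurable_posLog_left t)]
  refine lintegral_mono fun x => ?_
  rw [smoothKernelBound]
  split_ifs with h
  · refine le_trans ?_ (ofReal_inv_mul_lintegral_const ((1 - η) * x) hη _).le
    refine mul_le_mul' le_rfl ?_
    refine setLIntegral_mono' measurableSet_Ioo fun s hs => ?_
    refine posLog_le (by nlinarith) ?_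
    have h1 : (1 - η) * |x - y| = |(s - t) + (((1 - η) * x - s) - ((1 - η) * y - t))| := by
      rw [← abs_of_pos (show 0 < 1 - η by linarith), ← abs_mul,
        abs_of_pos (show 0 < 1 - η by linarith)]
      congr 1; ring
    have h2 := abs_add_le (s - t) (((1 - η) * x - s) - ((1 - η) * y - t))
    have h3 : |((1 - η) * x - s) - ((1 - η) * y - t)| ≤ η :=
      abs_le.2 ⟨by linarith [hs.2, ht.1], by linarith [hs.1, ht.2]⟩
    linarith
  · exact lintegral_posLog_Ioo_le _ t hη (by linarith)

/-- The domination needed for the reverse Fatou lemma. The threshold `4 * η` with `η ≤ 1 / 2` gives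
`(1 - η) * |x - y| - η ≥ |x - y| / 4`; below the threshold `η` itself exceeds `|x - y| / 4`. -/
lemma smoothKernelBound_le {η : ℝ} (hη : 0 < η) (hη2 : η ≤ 1 / 2) (x y : ℝ) :
    smoothKernelBound η x y ≤ posLog x y + ENNReal.ofReal (Real.log 4 + 2) := by
  rcases eq_or_ne x y with rfl | hxy
  · simp [posLog_self]
  have hd : 0 < |x - y| := abs_pos.2 (sub_ne_zero.2 hxy)
  rw [posLog_of_ne hxy]
  refine le_trans ?_ ENNReal.ofReal_add_le
  rw [smoothKernelBound]
  have h4 : Real.log (|x - y| / 4) = Real.log |x - y| - Real.log 4 :=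
    Real.log_div hd.ne' (by norm_num)
  split_ifs with h
  · refine ENNReal.ofReal_le_ofReal ?_
    have : Real.log (|x - y| / 4) ≤ Real.log ((1 - η) * |x - y| - η) :=
      Real.log_le_log (by positivity) (by nlinarith)
    linarith
  · refine ENNReal.ofReal_le_ofReal ?_
    have : Real.log (|x - y| / 4) ≤ Real.log η := Real.log_le_log (by positivity) (by linarith)
    linarith

lemma limsup_smoothKernelBound_le {η : ℕ → ℝ} (hη : Tendsto η atTop (𝓝 0)) (x y : ℝ) :
    limsup (fun n => smoothKernelBound (η n) x y) atTop ≤ posLog x y := by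
  rcases eq_or_ne x y with rfl | hxy
  · simp [posLog_self]
  have hd : 0 < |x - y| := abs_pos.2 (sub_ne_zero.2 hxy)
  rw [posLog_of_ne hxy]
  refine (Tendsto.limsup_eq ?_).le
  have h1 : Tendsto (fun n => ENNReal.ofReal (-Real.log ((1 - η n) * |x - y| - η n))) atTop
      (𝓝 (ENNReal.ofReal (-Real.log |x - y|))) := by
    refine ENNReal.tendsto_ofReal (Tendsto.neg ?_)
    refine (Real.continuousAt_log hd.ne').tendsto.comp ?_
    have := ((hη.const_sub 1).mul_const |x - y|).sub hη
    simpa using this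
  refine h1.congr' ?_
  have h4 : Tendsto (fun n => 4 * η n) atTop (𝓝 0) := by simpa using hη.const_mul 4
  filter_upwards [h4.eventually (gt_mem_nhds hd)] with n hn
  rw [smoothKernelBound, if_pos hn.le]

/-- Smoothing makes the measure absolutely continuous, and the contraction keeps it inside `(0, 1)`.
By reverse Fatou the limsup of the smoothed energies as `η → 0` is at most the original energy. -/
lemma exists_ac_posEnergy_lt (ν : Measure ℝ) [IsProbabilityMeasure ν] (hν : ν (Icc 0 1)ᶜ = 0)
    {B : ℝ≥0∞} (hB : posEnergy ν ν < B) :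
    ∃ ν' : Measure ℝ, IsProbabilityMeasure ν' ∧ ν' ≪ volume ∧ ν' (Ioo 0 1)ᶜ = 0 ∧
      posEnergy ν' ν' < B := by
  set η : ℕ → ℝ := fun n => 1 / ((n : ℝ) + 1) * (1 / 2) with hηdef
  have hη0 : ∀ n, 0 < η n := fun n => by positivity
  have hη2 : ∀ n, η n ≤ 1 / 2 := fun n => by
    have : 1 / ((n : ℝ) + 1) ≤ 1 := by
      rw [div_le_one (by positivity)]; linarith [Nat.cast_nonneg (α := ℝ) n]
    simp only [hηdef]; linarith
  have hηlim : Tendsto η atTop (𝓝 0) := by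
    have := (tendsto_one_div_add_atTop_nhds_zero_nat (𝕜 := ℝ)).mul_const (1 / 2)
    rwa [zero_mul] at this
  have hlimsup : limsup (fun n => ∫⁻ p, smoothKernelBound (η n) p.1 p.2 ∂(ν.prod ν)) atTop < B := by
    refine lt_of_le_of_lt ?_ hB
    rw [posEnergy_eq_prod]
    refine (limsup_lintegral_le
      (fun p => posLog p.1 p.2 + ENNReal.ofReal (Real.log 4 + 2))
      (fun n => measurable_smoothKernelBound (η n))
      (fun n => Eventually.of_forall fun p => smoothKernelBound_le (hη0 n) (hη2 n) p.1 p.2) ?_).trans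
      (lintegral_mono fun p => limsup_smoothKernelBound_le hηlim p.1 p.2)
    rw [lintegral_add_right _ measurable_const, ← posEnergy_eq_prod]
    simpa using hB.ne_top
  obtain ⟨n, hn⟩ := (eventually_lt_of_limsup_lt hlimsup).exists
  refine ⟨contractAndSmooth ν (η n), ⟨?_⟩, withDensity_absolutelyContinuous _ _, ?_, ?_⟩
  · rw [← lintegral_one, lintegral_contractAndSmooth ν _ measurable_const]
    simp_rw [ofReal_inv_mul_lintegral_const _ (hη0 n)]
    simp
  · rw [← lintegral_indicator_one measurableSet_Ioo.compl,
      lintegral_contractAndSmooth ν _ (measurable_one.indicator measurableSet_Ioo.compl)]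
    refine lintegral_eq_zero_of_ae_eq_zero ?_
    have hae : ∀ᵐ x ∂ν, x ∈ Icc (0 : ℝ) 1 := hν
    filter_upwards [hae] with x hx
    rw [Pi.zero_apply]
    refine mul_eq_zero_of_right _ ?_
    rw [setLIntegral_eq_zero_iff measurableSet_Ioo (measurable_one.indicator measurableSet_Ioo.compl)]
    refine Eventually.of_forall fun s hs => ?_
    have h1 : 0 < 1 - η n := by linarith [hη2 n]
    refine indicator_of_notMem ?_ _
    rw [notMem_compl_iff]
    exact ⟨by nlinarith [hs.1, hx.1], by nlinarith [hs.2, hx.2]⟩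
  · refine (posEnergy_contractAndSmooth_le ν (hη0 n) (hη2 n)).trans_lt (lt_of_eq_of_lt ?_ hn)
    rw [lintegral_prod_symm _ (measurable_smoothKernelBound _).aemeasurable]


/-! ### Weak limits: lower semicontinuity of energy and nested supports -/

/-- The truncated logarithmic kernel on the line, as a bounded continuous function. -/
def truncLog (T : ℝ≥0) : BoundedContinuousFunction (ℝ × ℝ) ℝ≥0 :=
  BoundedContinuousFunction.mkOfBound
    ⟨fun p => (min (posLog p.1 p.2) T).toNNReal, by
      refine continuous_iff_continuousAt.2 fun p => ?_
      refine (ENNReal.tendsto_toNNReal ?_).comp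
        (continuous_posLog.min continuous_const).continuousAt
      exact (lt_of_le_of_lt (min_le_right _ _) ENNReal.coe_lt_top).ne⟩ T (by
      intro p p'
      have h : ∀ p : ℝ × ℝ, (min (posLog p.1 p.2) T).toNNReal ≤ T := fun p =>
        by
        simpa using ENNReal.toNNReal_mono (ENNReal.coe_ne_top (r := T)) (min_le_right (posLog p.1 p.2) _)
      rw [NNReal.dist_eq, abs_le]
      have h1 : ((min (posLog p.1 p.2) T).toNNReal : ℝ) ≤ T := by exact_mod_cast h p
      have h2 : ((min (posLog p'.1 p'.2) T).toNNReal : ℝ) ≤ T := by exact_mod_cast h p'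
      have h3 := ((min (posLog p.1 p.2) T).toNNReal).coe_nonneg
      have h4 := ((min (posLog p'.1 p'.2) T).toNNReal).coe_nonneg
      constructor
      · simp only [ContinuousMap.coe_mk]; linarith
      · simp only [ContinuousMap.coe_mk]; linarith)

lemma coe_truncLog (T : ℝ≥0) (p : ℝ × ℝ) : (truncLog T p : ℝ≥0∞) = min (posLog p.1 p.2) T := by
  change (((min (posLog p.1 p.2) (T : ℝ≥0∞)).toNNReal : ℝ≥0) : ℝ≥0∞) = _
  exact ENNReal.coe_toNNReal (lt_of_le_of_lt (min_le_right _ _) ENNReal.coe_lt_top).ne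

/-- Lower semicontinuity of the energy. -/
lemma posEnergy_le_of_tendsto {ι : Type*} {L : Filter ι} [L.NeBot] {ν : ι → ProbabilityMeasure ℝ}
    {μ : ProbabilityMeasure ℝ} (h : Tendsto ν L (𝓝 μ)) {B : ℝ≥0∞}
    (hB : ∀ i, posEnergy (ν i : Measure ℝ) (ν i : Measure ℝ) ≤ B) :
    posEnergy (μ : Measure ℝ) (μ : Measure ℝ) ≤ B := by
  have hprod : Tendsto (fun i => (ν i).prod (ν i)) L (𝓝 (μ.prod μ)) :=
    (ProbabilityMeasure.continuous_prod.tendsto (μ, μ)).comp (h.prodMk_nhds h)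
  have htrunc : ∀ T : ℕ, ∫⁻ p, min (posLog p.1 p.2) T ∂((μ : Measure ℝ).prod μ) ≤ B := by
    intro T
    have h1 := ProbabilityMeasure.tendsto_iff_forall_lintegral_tendsto.1 hprod (truncLog T)
    simp only [coe_truncLog, ProbabilityMeasure.toMeasure_prod] at h1
    refine le_of_tendsto h1 (Eventually.of_forall fun i => ?_)
    refine le_trans (lintegral_mono fun p => min_le_left _ _) ?_
    rw [← posEnergy_eq_prod]
    exact hB i
  rw [posEnergy_eq_prod]
  have hsup : ∀ p : ℝ × ℝ, posLog p.1 p.2 = ⨆ T : ℕ, min (posLog p.1 p.2) (T : ℝ≥0∞) := by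
    intro p
    rw [← inf_iSup_eq, ENNReal.iSup_natCast, inf_top_eq]
  rw [lintegral_congr hsup, lintegral_iSup (fun T => measurable_posLog.min measurable_const)]
  · exact iSup_le htrunc
  · intro S T hST p
    exact min_le_min_left _ (by exact_mod_cast hST)

/-- Compactness of the probability measures on `[0, 1]` yields a weak limit, here along an
ultrafilter. Weak limits respect only closed sets, which is why the nesting is required of the
closures. -/
lemma exists_limit_measure {B : ℝ≥0∞} {U V : ℕ → Set ℝ} {ν : ℕ → Measure ℝ}
    (hU0 : U 0 ⊆ Icc 0 1) (hU : ∀ j, closure (U (j + 1)) ⊆ U j ∩ V j)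
    (hν : ∀ j, IsProbabilityMeasure (ν j)) (hνU : ∀ j, ν j (U j)ᶜ = 0)
    (hB : ∀ j, posEnergy (ν j) (ν j) ≤ B) :
    ∃ K ⊆ ⋂ j, V j, IsCompact K ∧ ∃ μ : Measure ℝ, IsProbabilityMeasure μ ∧ μ Kᶜ = 0 ∧
      posEnergy μ μ ≤ B := by
  have hanti : Antitone U := antitone_nat_of_succ_le fun j =>
    subset_closure.trans ((hU j).trans inter_subset_left)
  have hcl : ∀ j, closure (U j) ⊆ Icc 0 1 := fun j =>
    closure_minimal ((hanti (Nat.zero_le j)).trans hU0) isClosed_Icc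
  set ν' : ℕ → ProbabilityMeasure ℝ := fun j => ⟨ν j, hν j⟩ with hν'
  have hcomp := isCompact_setOfPred_probabilityMeasure_mass_eq_compl_isCompact_le (E := ℝ)
    (u := fun _ => 0) (K := fun _ => Icc (0 : ℝ) 1) tendsto_const_nhds (fun _ => isCompact_Icc)
    (Or.inl inferInstance)
  have hmem : ∀ j, ν' j ∈ {μ : ProbabilityMeasure ℝ | ∀ _ : ℕ, μ (Icc (0 : ℝ) 1)ᶜ ≤ 0} := by
    intro j _
    have h0 : ν j (Icc (0 : ℝ) 1)ᶜ = 0 :=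
      measure_mono_null (compl_subset_compl.2 (subset_closure.trans (hcl j))) (hνU j)
    have : ((ν' j (Icc (0 : ℝ) 1)ᶜ : ℝ≥0) : ℝ≥0∞) = 0 := by
      rw [ProbabilityMeasure.ennreal_coeFn_eq_coeFn_toMeasure]; exact h0
    exact (ENNReal.coe_eq_zero.1 this).le
  obtain ⟨μ, -, hμ⟩ := hcomp.ultrafilter_le_nhds ((hyperfilter ℕ).map ν')
    (tendsto_principal.2 (Eventually.of_forall hmem))
  have hlim : Tendsto ν' (hyperfilter ℕ) (𝓝 μ) := hμ
  have hnull : ∀ j, (μ : Measure ℝ) (closure (U j))ᶜ = 0 := by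
    intro j
    refine le_antisymm ?_ bot_le
    -- Portmanteau inequality for the open complement of `closure (U j)`, which is null for every `ν
    -- i` with `i ≥ j`.
    refine (ProbabilityMeasure.le_liminf_measure_open_of_tendsto hlim
      isClosed_closure.isOpen_compl).trans (le_of_eq ?_)
    refine Tendsto.liminf_eq (tendsto_const_nhds.congr' ?_)
    have : ∀ᶠ i : ℕ in hyperfilter ℕ, j ≤ i :=
      Nat.hyperfilter_le_atTop (eventually_ge_atTop j)
    filter_upwards [this] with i hi
    exact (measure_mono_null (compl_subset_compl.2 ((hanti hi).trans subset_closure)) (hνU i)).symm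
  refine ⟨⋂ j, closure (U j), ?_, ?_, μ, inferInstance, ?_, ?_⟩
  · exact subset_iInter fun j => (iInter_subset _ (j + 1)).trans ((hU j).trans inter_subset_right)
  · exact isCompact_Icc.of_isClosed_subset (isClosed_iInter fun j => isClosed_closure)
      ((iInter_subset _ 0).trans (hcl 0))
  · rw [compl_iInter]
    exact measure_iUnion_null hnull
  · exact posEnergy_le_of_tendsto hlim hB


/-! ### Empirical measures of the blocks and equidistribution -/

lemma card_block (N : ℕ) : (block N).card = N := by simp [block]; omega

/-- The uniform distribution on the centers with indices in the block `A_N`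
(and an arbitrary point mass for `N = 0`). -/
def blockMeasure (c : ℕ → ℝ) (N : ℕ) : Measure ℝ :=
  if N = 0 then Measure.dirac 0 else (N : ℝ≥0∞)⁻¹ • ∑ k ∈ block N, Measure.dirac (c k)

instance (c : ℕ → ℝ) (N : ℕ) : IsProbabilityMeasure (blockMeasure c N) := by
  rw [blockMeasure]
  split_ifs with h
  · infer_instance
  · refine ⟨?_⟩
    simp [card_block, ENNReal.inv_mul_cancel, h]

/-- `blockMeasure` as a bundled probability measure. -/
def blockProb (c : ℕ → ℝ) (N : ℕ) : ProbabilityMeasure ℝ := ⟨blockMeasure c N, inferInstance⟩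

lemma coe_blockProb (c : ℕ → ℝ) (N : ℕ) : (blockProb c N : Measure ℝ) = blockMeasure c N := rfl

lemma lintegral_blockMeasure (c : ℕ → ℝ) {N : ℕ} (hN : N ≠ 0) (f : ℝ → ℝ≥0∞) :
    ∫⁻ x, f x ∂(blockMeasure c N) = (N : ℝ≥0∞)⁻¹ * ∑ k ∈ block N, f (c k) := by
  rw [blockMeasure, if_neg hN, lintegral_smul_measure, lintegral_finsetSum_measure, smul_eq_mul]
  simp

lemma integral_blockMeasure (c : ℕ → ℝ) {N : ℕ} (hN : N ≠ 0) (f : ℝ → ℝ) :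
    ∫ x, f x ∂(blockMeasure c N) = (∑ k ∈ block N, f (c k)) / ((block N).card : ℝ) := by
  rw [blockMeasure, if_neg hN, integral_smul_measure, integral_finsetSum_measure, card_block]
  · simp [div_eq_inv_mul]
  · intro k _
    exact integrable_dirac (by simp)

/-- The limit is `φ dx`. Positivity of `φ` almost everywhere makes Lebesgue measure on `[0, 1]`
absolutely continuous with respect to it, so every absolutely continuous law on `[0, 1]` has a
density against `P`. -/
lemma exists_tendsto_blockMeasure {c : ℕ → ℝ} (h : CentersDistributed c) :
    ∃ P : ProbabilityMeasure ℝ, volume.restrict (Icc (0 : ℝ) 1) ≪ (P : Measure ℝ) ∧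
      Tendsto (blockProb c) atTop (𝓝 P) := by
  obtain ⟨φ, hφ, hpos, hlim⟩ := h
  have hae : AEMeasurable (fun x => ENNReal.ofReal (φ x)) (volume.restrict (Icc (0 : ℝ) 1)) :=
    hφ.aestronglyMeasurable.aemeasurable.ennreal_ofReal
  -- Testing the convergence on the constant 1 shows that `φ` has total mass 1.
  have hint : ∫ x in Icc (0 : ℝ) 1, φ x = 1 := by
    have h1 := hlim (fun _ => 1) continuousOn_const
    simp only [one_mul] at h1
    refine tendsto_nhds_unique h1 (tendsto_const_nhds.congr' ?_)
    filter_upwards [eventually_ne_atTop 0] with n hn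
    have : ((block n).card : ℝ) ≠ 0 := by rw [card_block]; exact_mod_cast hn
    simp [div_self this]
  have hprob : IsProbabilityMeasure
      ((volume.restrict (Icc (0 : ℝ) 1)).withDensity fun x => ENNReal.ofReal (φ x)) := by
    refine ⟨?_⟩
    rw [withDensity_apply _ MeasurableSet.univ, Measure.restrict_univ,
      ← ofReal_integral_eq_lintegral_ofReal hφ, hint, ENNReal.ofReal_one]
    filter_upwards [hpos] with x hx using hx.le
  refine ⟨(⟨_, hprob⟩ : ProbabilityMeasure ℝ), ?_, ?_⟩
  · refine withDensity_absolutelyContinuous' hae ?_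
    filter_upwards [hpos] with x hx
    simpa using hx
  · refine ProbabilityMeasure.tendsto_iff_forall_integral_tendsto.2 ?_
    intro f
    have h1 := hlim f f.continuous.continuousOn
    have h2 : ∫ x, f x ∂((volume.restrict (Icc (0 : ℝ) 1)).withDensity
        fun x => ENNReal.ofReal (φ x)) = ∫ x in Icc (0 : ℝ) 1, f x * φ x := by
      rw [integral_withDensity_eq_integral_toReal_smul₀ hae
        (Eventually.of_forall fun x => ENNReal.ofReal_lt_top)]
      refine integral_congr_ae ?_
      filter_upwards [hpos] with x hx
      rw [ENNReal.toReal_ofReal hx.le, smul_eq_mul, mul_comm]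
    change Tendsto _ _ (𝓝 (∫ x, f x ∂((volume.restrict (Icc (0 : ℝ) 1)).withDensity
        fun x => ENNReal.ofReal (φ x))))
    rw [h2]
    refine h1.congr' ?_
    filter_upwards [eventually_ne_atTop 0] with N hN
    exact (integral_blockMeasure c hN f).symm

lemma eventually_lt_blockAverage {c : ℕ → ℝ} {P : ProbabilityMeasure ℝ}
    (h : Tendsto (blockProb c) atTop (𝓝 P))
    (g : ℝ →ᵇ ℝ≥0) {r : ℝ≥0∞} (hr : r < ∫⁻ x, g x ∂(P : Measure ℝ)) :
    ∀ᶠ n : ℕ in atTop, ∀ N ≥ n, r < (N : ℝ≥0∞)⁻¹ * ∑ k ∈ block N, (g (c k) : ℝ≥0∞) := by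
  have h1 := ProbabilityMeasure.tendsto_iff_forall_lintegral_tendsto.1 h g
  obtain ⟨m, hm⟩ := (h1.eventually (lt_mem_nhds hr)).exists_forall_of_atTop
  filter_upwards [eventually_ge_atTop (max m 1)] with n hn N hN
  have h2 := hm N (by omega)
  rwa [coe_blockProb, lintegral_blockMeasure c (by omega)] at h2

/-- The integrand is bounded and continuous because the kernel is truncated, and products of block
measures converge as both indices tend to infinity independently. The bound thus holds at once for
all pairs of blocks `A_{2^s n}`, `A_{2^t n}`. -/
lemma eventually_doubleBlockAverage_lt {c : ℕ → ℝ} {P : ProbabilityMeasure ℝ}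
    (h : Tendsto (blockProb c) atTop (𝓝 P))
    (g : ℝ →ᵇ ℝ≥0) (T : ℝ≥0) {G : ℝ≥0∞}
    (hG : ∫⁻ y, ∫⁻ x, (g x : ℝ≥0∞) * g y * min (posLog x y) T ∂(P : Measure ℝ) ∂(P : Measure ℝ) < G) :
    ∀ᶠ n : ℕ in atTop, ∀ N ≥ n, ∀ N' ≥ n, (N : ℝ≥0∞)⁻¹ * (N' : ℝ≥0∞)⁻¹ *
      ∑ i ∈ block N, ∑ j ∈ block N', (g (c i) : ℝ≥0∞) * g (c j) * min (posLog (c i) (c j)) T < G := by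
  set F : ℝ × ℝ →ᵇ ℝ≥0 := g.compContinuous ⟨Prod.fst, continuous_fst⟩ *
    g.compContinuous ⟨Prod.snd, continuous_snd⟩ * truncLog T with hF
  have hFp : ∀ p : ℝ × ℝ, (F p : ℝ≥0∞) = (g p.1 : ℝ≥0∞) * g p.2 * min (posLog p.1 p.2) T := by
    intro p
    rw [← coe_truncLog]
    simp [hF]
  have hprod : Tendsto (fun N : ℕ × ℕ => (blockProb c N.1).prod (blockProb c N.2)) atTop (𝓝 (P.prod P)) := by
    have h2 : Tendsto (fun N : ℕ × ℕ => (blockProb c N.1, blockProb c N.2)) atTop (𝓝 (P, P)) := by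
      rw [← prod_atTop_atTop_eq, nhds_prod_eq]
      exact h.prodMap h
    exact (ProbabilityMeasure.continuous_prod.tendsto (P, P)).comp h2
  have h1 := ProbabilityMeasure.tendsto_iff_forall_lintegral_tendsto.1 hprod F
  have hFm : Measurable fun p => (F p : ℝ≥0∞) := F.continuous.measurable.coe_nnreal_ennreal
  have hG' : ∫⁻ p, F p ∂((P.prod P : ProbabilityMeasure (ℝ × ℝ)) : Measure (ℝ × ℝ)) < G := by
    rw [ProbabilityMeasure.toMeasure_prod, lintegral_prod_symm _ hFm.aemeasurable]
    simpa only [hFp] using hG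
  obtain ⟨m, hm⟩ := (h1.eventually (gt_mem_nhds hG')).exists_forall_of_atTop
  filter_upwards [eventually_ge_atTop (max (max m.1 m.2) 1)] with n hn N hN N' hN'
  have h2 := hm (N, N') ⟨by simp; omega, by simp; omega⟩
  rw [ProbabilityMeasure.toMeasure_prod, lintegral_prod _ hFm.aemeasurable] at h2
  simp only [coe_blockProb, hFp] at h2
  rw [lintegral_blockMeasure c (by omega)] at h2
  simp_rw [lintegral_blockMeasure c (show N' ≠ 0 by omega), ← Finset.mul_sum] at h2
  rwa [mul_assoc]


/-! ### Approximation by continuous densities -/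

/-- A bounded compactly carried density nearly exhausting an absolutely continuous probability. -/
lemma exists_bounded_density {P ν : Measure ℝ} [IsProbabilityMeasure P] [IsProbabilityMeasure ν]
    (hνP : ν ≪ P) {U : Set ℝ} (hU : IsOpen U) (hνU : ν Uᶜ = 0) {r : ℝ≥0∞} (hr : r < 1) :
    ∃ (M : ℝ≥0) (K : Set ℝ) (F : ℝ → ℝ≥0∞), IsCompact K ∧ K ⊆ U ∧ Measurable F ∧ (∀ x, F x ≤ M) ∧
      (∀ x ∉ K, F x = 0) ∧ r < ∫⁻ x, F x ∂P ∧ P.withDensity F ≤ ν := by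
  have hU1 : ν U = 1 := (prob_compl_eq_zero_iff hU.measurableSet).1 hνU
  obtain ⟨K, hKU, hK, hrK⟩ := hU.exists_lt_isCompact (μ := ν) (r := r) (by rwa [hU1])
  set ρ := ν.rnDeriv P with hρ
  have hρm : Measurable ρ := Measure.measurable_rnDeriv ν P
  have hwd : P.withDensity ρ = ν := Measure.withDensity_rnDeriv_eq ν P hνP
  have hsup : ⨆ n : ℕ, ∫⁻ x in K, min (ρ x) n ∂P = ν K := by
    rw [← lintegral_iSup (fun n => hρm.min measurable_const)]
    · conv_rhs => rw [← hwd, withDensity_apply _ hK.measurableSet]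
      refine lintegral_congr fun x => ?_
      rw [← inf_iSup_eq, ENNReal.iSup_natCast, inf_top_eq]
    · intro S T hST x
      exact min_le_min_left _ (by exact_mod_cast hST)
  obtain ⟨n, hn⟩ := lt_iSup_iff.1 (hsup.symm ▸ hrK)
  refine ⟨n, K, K.indicator fun x => min (ρ x) n, hK, hKU,
    (hρm.min measurable_const).indicator hK.measurableSet, ?_, ?_, ?_, ?_⟩
  · intro x
    refine (indicator_le_self' (fun _ _ => zero_le) x).trans ?_
    simp
  · exact fun x hx => indicator_of_notMem hx _
  · rwa [lintegral_indicator hK.measurableSet]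
  · rw [← hwd]
    refine withDensity_mono (Eventually.of_forall fun x => ?_)
    exact (indicator_le_self' (fun _ _ => zero_le) x).trans (min_le_left _ _)

/-- Approximation of a bounded density in `L¹` by a continuous one, keeping the support in `U`. -/
lemma exists_continuous_density {P : Measure ℝ} [IsProbabilityMeasure P] {M : ℝ≥0} {K U : Set ℝ}
    {F : ℝ → ℝ≥0∞} (hK : IsCompact K) (hU : IsOpen U) (hKU : K ⊆ U) (hF : Measurable F)
    (hFM : ∀ x, F x ≤ M) (hFK : ∀ x ∉ K, F x = 0) {η : ℝ≥0∞} (hη : η ≠ 0) :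
    ∃ (g : ℝ →ᵇ ℝ≥0) (d : ℝ → ℝ≥0∞) (K' : Set ℝ), Measurable d ∧ IsCompact K' ∧ K' ⊆ U ∧
      (∀ x, g x ≤ M) ∧ (∀ x ∉ K', g x = 0) ∧ (∀ x, F x ≤ g x + d x) ∧ (∀ x, g x ≤ F x + d x) ∧
      ∫⁻ x, d x ∂P ≤ η := by
  have hFtop : ∀ x, F x ≠ ⊤ := fun x => ne_top_of_le_ne_top ENNReal.coe_ne_top (hFM x)
  have hfM : ∀ x, (F x).toReal ≤ M := fun x => by
    simpa using ENNReal.toReal_mono ENNReal.coe_ne_top (hFM x)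
  have hint : Integrable (fun x => (F x).toReal) P := by
    refine Integrable.of_bound hF.ennreal_toReal.aestronglyMeasurable M
      (Eventually.of_forall fun x => ?_)
    rw [Real.norm_of_nonneg ENNReal.toReal_nonneg]
    exact hfM x
  obtain ⟨h, hh, -⟩ := hint.exists_boundedContinuous_lintegral_sub_le hη
  obtain ⟨L, hL, hKL, hLU⟩ := exists_compact_between hK hU hKU
  obtain ⟨χ, hχ1, hχ0, -, hχ⟩ := exists_continuous_one_zero_of_isCompact hK
    (isOpen_interior (s := L)).isClosed_compl (disjoint_compl_right_iff_subset.2 hKL)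
  have hgM : ∀ x, χ x * max 0 (min (h x) M) ≤ M := fun x => by
    have h1 : max 0 (min (h x) M) ≤ M := max_le M.coe_nonneg (min_le_right _ _)
    calc _ ≤ 1 * max 0 (min (h x) M) :=
          mul_le_mul_of_nonneg_right (hχ x).2 (le_max_left _ _)
      _ ≤ M := by rwa [one_mul]
  have hg0 : ∀ x, 0 ≤ χ x * max 0 (min (h x) M) := fun x =>
    mul_nonneg (hχ x).1 (le_max_left _ _)
  set g : ℝ →ᵇ ℝ≥0 := BoundedContinuousFunction.mkOfBound
    ⟨fun x => (χ x * max 0 (min (h x) M)).toNNReal, by fun_prop⟩ M (by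
      intro x y
      rw [ContinuousMap.coe_mk, NNReal.dist_eq, Real.coe_toNNReal _ (hg0 x),
        Real.coe_toNNReal _ (hg0 y), abs_le]
      constructor <;> linarith [hg0 x, hg0 y, hgM x, hgM y]) with hg
  have hgx : ∀ x, (g x : ℝ≥0∞) = ENNReal.ofReal (χ x * max 0 (min (h x) M)) := fun x => rfl
  -- Clamping `h` to `[0, M]` moves it no further from `F`, whose values lie there. The cutoff `χ`
  -- is 1 on `K`, and off `K` it shrinks towards the value 0 of `F`.
  have hclose : ∀ x, |(F x).toReal - χ x * max 0 (min (h x) M)| ≤ |(F x).toReal - h x| := by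
    intro x
    have hf0 : 0 ≤ (F x).toReal := ENNReal.toReal_nonneg
    have h1 : |(F x).toReal - max 0 (min (h x) M)| ≤ |(F x).toReal - h x| := by
      have := hfM x
      rcases le_total (h x) M with hm | hm
      · rw [min_eq_left hm]
        rcases le_total 0 (h x) with hz | hz
        · rw [max_eq_right hz]
        · rw [max_eq_left hz, abs_of_nonneg (by linarith), abs_of_nonneg (by linarith)]
          linarith
      · rw [min_eq_right hm, max_eq_right M.coe_nonneg, abs_of_nonpos (by linarith),
          abs_of_nonpos (by linarith)]
        linarith
    by_cases hx : x ∈ K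
    · rw [hχ1 hx]
      simpa using h1
    · refine le_trans ?_ h1
      rw [hFK x hx]
      simp only [ENNReal.toReal_zero, zero_sub, abs_neg, abs_mul, abs_of_nonneg (hχ x).1]
      exact mul_le_of_le_one_left (abs_nonneg _) (hχ x).2
  refine ⟨g, fun x => ‖(F x).toReal - h x‖ₑ, L, ?_, hL, hLU, ?_, ?_, ?_, ?_, hh⟩
  · exact (hF.ennreal_toReal.sub h.continuous.measurable).enorm
  · intro x
    rw [← ENNReal.coe_le_coe, hgx]
    exact ENNReal.ofReal_le_of_le_toReal (by simpa using hgM x)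
  · intro x hx
    have : χ x = 0 := hχ0 (fun hx' => hx (interior_subset hx'))
    rw [← ENNReal.coe_eq_zero, hgx, this]
    simp
  · intro x
    beta_reduce
    rw [hgx, Real.enorm_eq_ofReal_abs, ← ENNReal.ofReal_toReal (hFtop x),
      ENNReal.toReal_ofReal ENNReal.toReal_nonneg,
      ← ENNReal.ofReal_add (hg0 x) (abs_nonneg _)]
    refine ENNReal.ofReal_le_ofReal ?_
    linarith [hclose x, le_abs_self ((F x).toReal - χ x * max 0 (min (h x) M))]
  · intro x
    beta_reduce
    rw [hgx, Real.enorm_eq_ofReal_abs, ← ENNReal.ofReal_toReal (hFtop x),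
      ENNReal.toReal_ofReal ENNReal.toReal_nonneg,
      ← ENNReal.ofReal_add ENNReal.toReal_nonneg (abs_nonneg _)]
    refine ENNReal.ofReal_le_ofReal ?_
    linarith [hclose x, neg_abs_le ((F x).toReal - χ x * max 0 (min (h x) M))]

lemma posEnergy_mono {μ ν : Measure ℝ} (h : μ ≤ ν) : posEnergy μ μ ≤ posEnergy ν ν :=
  lintegral_mono' h fun _ => lintegral_mono' h le_rfl

lemma posEnergy_withDensity (P : Measure ℝ) [SFinite P] {F : ℝ → ℝ≥0∞} (hF : Measurable F) :
    posEnergy (P.withDensity F) (P.withDensity F)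
      = ∫⁻ y, ∫⁻ x, F x * F y * posLog x y ∂P ∂P := by
  have hm : Measurable fun y : ℝ => ∫⁻ x, posLog x y ∂(P.withDensity F) :=
    measurable_posLog.lintegral_prod_left'
  rw [posEnergy, lintegral_withDensity_eq_lintegral_mul _ hF hm]
  refine lintegral_congr fun y => ?_
  rw [Pi.mul_apply, lintegral_withDensity_eq_lintegral_mul _ hF (measurable_posLog_left y),
    ← lintegral_const_mul _ (hF.mul (measurable_posLog_left y))]
  refine lintegral_congr fun x => ?_
  simp only [Pi.mul_apply]
  ring

/-- An absolutely continuous probability measure of finite energy can be replaced by one with a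
continuous density, at a small cost of mass and (truncated) energy. The bound `M` on the density
does not depend on the truncation level. -/
lemma exists_continuous_density_energy {P ν : Measure ℝ} [IsProbabilityMeasure P]
    [IsProbabilityMeasure ν] (hνP : ν ≪ P) {U : Set ℝ} (hU : IsOpen U) (hνU : ν Uᶜ = 0)
    {r : ℝ≥0∞} (hr : r < 1) :
    ∃ M : ℝ≥0, ∀ T η : ℝ≥0, η ≠ 0 → ∃ (g : ℝ →ᵇ ℝ≥0) (K : Set ℝ), IsCompact K ∧ K ⊆ U ∧
      (∀ x, g x ≤ M) ∧ (∀ x ∉ K, g x = 0) ∧ r < ∫⁻ x, g x ∂P ∧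
      ∫⁻ y, ∫⁻ x, (g x : ℝ≥0∞) * g y * min (posLog x y) T ∂P ∂P ≤ posEnergy ν ν + η := by
  obtain ⟨M, K, F, hK, hKU, hF, hFM, hFK, hrF, hle⟩ := exists_bounded_density hνP hU hνU hr
  refine ⟨M, fun T η hη => ?_⟩
  obtain ⟨κ, hκ0, hκ⟩ := ENNReal.lt_iff_exists_add_pos_lt.1 hrF
  -- The first bound protects the mass, where `κ` is the slack above `r`. The second protects the
  -- energy, where the `L¹` error enters twice with factor `M * T`.
  set η' : ℝ≥0 := min κ (η / (2 * M * T + 1)) with hη'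
  have hη'0 : (η' : ℝ≥0∞) ≠ 0 := by
    have : 0 < η' := lt_min hκ0 (div_pos (pos_iff_ne_zero.2 hη) (by positivity))
    exact_mod_cast this.ne'
  obtain ⟨g, d, K', hd, hK', hK'U, hgM, hgK', hFg, hgF, hdη⟩ :=
    exists_continuous_density (P := P) hK hU hKU hF hFM hFK hη'0
  have hgm : Measurable fun x => (g x : ℝ≥0∞) := g.continuous.measurable.coe_nnreal_ennreal
  refine ⟨g, K', hK', hK'U, hgM, hgK', ?_, ?_⟩
  · have h1 : ∫⁻ x, F x ∂P ≤ ∫⁻ x, g x ∂P + κ := by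
      calc _ ≤ ∫⁻ x, (g x + d x) ∂P := lintegral_mono hFg
        _ = ∫⁻ x, g x ∂P + ∫⁻ x, d x ∂P := lintegral_add_left hgm _
        _ ≤ _ := by
          gcongr
          exact hdη.trans (ENNReal.coe_le_coe.2 (min_le_left _ _))
    exact lt_of_add_lt_add_right (hκ.trans_le h1)
  · have hpt : ∀ x y, (g x : ℝ≥0∞) * g y * min (posLog x y) T
        ≤ F x * F y * posLog x y + ((M * T : ℝ≥0∞) * d x + (M * T : ℝ≥0∞) * d y) := by
      intro x y
      have hg1 : ∀ x, (g x : ℝ≥0∞) ≤ M := fun x => ENNReal.coe_le_coe.2 (hgM x)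
      have h1 : (g x : ℝ≥0∞) * g y ≤ F x * F y + M * (d x + d y) := by
        calc (g x : ℝ≥0∞) * g y ≤ (F x + d x) * g y := by gcongr; exact hgF x
          _ = F x * g y + d x * g y := add_mul _ _ _
          _ ≤ F x * (F y + d y) + d x * M := by gcongr; exacts [hgF y, hgM y]
          _ = F x * F y + (F x * d y + d x * M) := by ring
          _ ≤ F x * F y + (M * d y + d x * M) := by gcongr; exact hFM x
          _ = _ := by ring
      calc _ ≤ (F x * F y + M * (d x + d y)) * min (posLog x y) T := by gcongr
        _ = F x * F y * min (posLog x y) T + M * (d x + d y) * min (posLog x y) T := add_mul _ _ _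
        _ ≤ F x * F y * posLog x y + M * (d x + d y) * T := by
          gcongr
          exacts [min_le_left _ _, min_le_right _ _]
        _ = _ := by ring
    have hFFm : Measurable fun p : ℝ × ℝ => F p.1 * F p.2 * posLog p.1 p.2 :=
      ((hF.comp measurable_fst).mul (hF.comp measurable_snd)).mul measurable_posLog
    calc _ ≤ ∫⁻ y, ∫⁻ x, (F x * F y * posLog x y + ((M * T : ℝ≥0∞) * d x + (M * T : ℝ≥0∞) * d y))
          ∂P ∂P := lintegral_mono fun y => lintegral_mono fun x => hpt x y
      _ = ∫⁻ y, (∫⁻ x, F x * F y * posLog x y ∂P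
          + ((M * T : ℝ≥0∞) * ∫⁻ x, d x ∂P + (M * T : ℝ≥0∞) * d y)) ∂P := by
        refine lintegral_congr fun y => ?_
        have h2 : Measurable fun x => F x * F y * posLog x y :=
          hFFm.comp (measurable_id.prodMk measurable_const)
        rw [lintegral_add_left h2,
          lintegral_add_right _ measurable_const, lintegral_const_mul _ hd]
        simp
      _ = posEnergy (P.withDensity F) (P.withDensity F) +
          ((M * T : ℝ≥0∞) * ∫⁻ x, d x ∂P + (M * T : ℝ≥0∞) * ∫⁻ x, d x ∂P) := by
        rw [lintegral_add_left hFFm.lintegral_prod_left', lintegral_add_left measurable_const,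
          lintegral_const_mul _ hd, posEnergy_withDensity P hF]
        simp
      _ ≤ posEnergy ν ν + ((M * T : ℝ≥0∞) * η' + (M * T : ℝ≥0∞) * η') := by
        gcongr
        exact posEnergy_mono hle
      _ ≤ _ := by
        gcongr
        have h2 : M * T * η' + M * T * η' ≤ η := by
          have h3 : η' ≤ η / (2 * M * T + 1) := min_le_right _ _
          calc _ = (2 * M * T) * η' := by ring
            _ ≤ (2 * M * T + 1) * (η / (2 * M * T + 1)) := by gcongr; exact le_self_add
            _ = η := mul_div_cancel₀ _ (by positivity)
        exact_mod_cast h2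


/-! ### Energies of uniform laws on small intervals and of their weighted sums -/

/-- The uniform probability distribution on the interval of center `c` and length `ℓ`. -/
def uniformInterval (c ℓ : ℝ) : Measure ℝ :=
  ENNReal.ofReal ℓ⁻¹ • volume.restrict (Ioo (c - ℓ / 2) (c + ℓ / 2))

lemma isProbabilityMeasure_uniformInterval (c : ℝ) {ℓ : ℝ} (hℓ : 0 < ℓ) :
    IsProbabilityMeasure (uniformInterval c ℓ) := by
  refine ⟨?_⟩
  rw [uniformInterval, Measure.smul_apply, Measure.restrict_apply_univ, Real.volume_Ioo, smul_eq_mul,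
    ← ENNReal.ofReal_mul (by positivity), show ℓ⁻¹ * (c + ℓ / 2 - (c - ℓ / 2)) = 1 by
      field_simp; ring, ENNReal.ofReal_one]

lemma uniformInterval_compl (c ℓ : ℝ) :
    uniformInterval c ℓ (Ioo (c - ℓ / 2) (c + ℓ / 2))ᶜ = 0 := by
  simp [uniformInterval, Measure.restrict_apply measurableSet_Ioo.compl]

lemma uniformInterval_absolutelyContinuous (c ℓ : ℝ) : uniformInterval c ℓ ≪ volume :=
  (Measure.absolutelyContinuous_of_le Measure.restrict_le_self).smul_left _

lemma posEnergy_uniformInterval_self_le (c : ℝ) {ℓ : ℝ} (hℓ : 0 < ℓ) (hℓ1 : ℓ ≤ 1) :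
    posEnergy (uniformInterval c ℓ) (uniformInterval c ℓ) ≤ ENNReal.ofReal (-Real.log ℓ + 2) := by
  have := isProbabilityMeasure_uniformInterval c hℓ
  calc _ ≤ ∫⁻ _, ENNReal.ofReal (-Real.log ℓ + 2) ∂(uniformInterval c ℓ) := by
        refine lintegral_mono fun y => ?_
        rw [uniformInterval, lintegral_smul_measure, smul_eq_mul]
        have := lintegral_posLog_Ioo_le (c - ℓ / 2) y hℓ hℓ1
        rwa [show c - ℓ / 2 + ℓ = c + ℓ / 2 by ring] at this
    _ = _ := by simp

/-- Points of the two intervals are at distance at least `(1 - ε) * |c - c'|`, and `-log (1 - ε) ≤ 2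
* ε` for `ε ≤ 1 / 2`. -/
lemma posEnergy_uniformInterval_le {c c' ℓ ℓ' ε : ℝ} (hℓ : 0 < ℓ) (hℓ' : 0 < ℓ') (hε : 0 ≤ ε)
    (hε2 : ε ≤ 1 / 2) (hc : c ≠ c') (h : (ℓ + ℓ') / 2 ≤ ε * |c - c'|) :
    posEnergy (uniformInterval c ℓ) (uniformInterval c' ℓ')
      ≤ posLog c c' + ENNReal.ofReal (2 * ε) := by
  have := isProbabilityMeasure_uniformInterval c hℓ
  have := isProbabilityMeasure_uniformInterval c' hℓ'
  have hae : ∀ᵐ x ∂(uniformInterval c ℓ), x ∈ Ioo (c - ℓ / 2) (c + ℓ / 2) :=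
    uniformInterval_compl c ℓ
  have hae' : ∀ᵐ x ∂(uniformInterval c' ℓ'), x ∈ Ioo (c' - ℓ' / 2) (c' + ℓ' / 2) :=
    uniformInterval_compl c' ℓ'
  have hd : 0 < |c - c'| := abs_pos.2 (sub_ne_zero.2 hc)
  have hlog : -Real.log ((1 - ε) * |c - c'|) ≤ -Real.log |c - c'| + 2 * ε := by
    rw [Real.log_mul (by linarith) hd.ne']
    have h1 := Real.one_sub_inv_le_log_of_pos (show 0 < 1 - ε by linarith)
    have h2 : (1 - ε)⁻¹ ≤ 1 + 2 * ε := by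
      rw [inv_le_iff_one_le_mul₀ (by linarith)]
      nlinarith
    linarith
  calc _ ≤ ∫⁻ _, ∫⁻ _, (posLog c c' + ENNReal.ofReal (2 * ε))
          ∂(uniformInterval c ℓ) ∂(uniformInterval c' ℓ') := by
        refine lintegral_mono_ae ?_
        filter_upwards [hae'] with y hy
        refine lintegral_mono_ae ?_
        filter_upwards [hae] with x hx
        rw [posLog_of_ne hc]
        refine le_trans ?_ ENNReal.ofReal_add_le
        refine (posLog_le (a := (1 - ε) * |c - c'|) (mul_pos (by linarith) hd) ?_).trans
          (ENNReal.ofReal_le_ofReal hlog)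
        have h1 : |c - c'| ≤ |x - y| + (ℓ + ℓ') / 2 := by
          refine abs_le.2 ⟨?_, ?_⟩
          · linarith [hx.1, hx.2, hy.1, hy.2, neg_abs_le (x - y)]
          · linarith [hx.1, hx.2, hy.1, hy.2, le_abs_self (x - y)]
        linarith
    _ = _ := by simp

lemma posEnergy_smul (a b : ℝ≥0∞) (μ ν : Measure ℝ) [SFinite μ] :
    posEnergy (a • μ) (b • ν) = a * b * posEnergy μ ν := by
  have hm : Measurable fun y : ℝ => ∫⁻ x, posLog x y ∂μ := measurable_posLog.lintegral_prod_left'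
  simp only [posEnergy, lintegral_smul_measure, smul_eq_mul]
  rw [lintegral_const_mul _ hm]
  ring

lemma posEnergy_sum {ι κ : Type*} (S : Finset ι) (S' : Finset κ) (μ : ι → Measure ℝ)
    (ν : κ → Measure ℝ) (hμ : ∀ i, SFinite (μ i)) :
    posEnergy (∑ i ∈ S, μ i) (∑ j ∈ S', ν j) = ∑ i ∈ S, ∑ j ∈ S', posEnergy (μ i) (ν j) := by
  have hm : ∀ i, Measurable fun y : ℝ => ∫⁻ x, posLog x y ∂(μ i) := fun i =>
    measurable_posLog.lintegral_prod_left'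
  simp only [posEnergy, lintegral_finsetSum_measure]
  rw [Finset.sum_comm]
  refine Finset.sum_congr rfl fun j _ => ?_
  exact lintegral_finsetSum _ fun i _ => hm i

/-- Splitting of a weighted double sum into its truncated, near-diagonal, error and diagonal
parts. -/
lemma sum_weighted_le (A A' : Finset ℕ) {w : ℕ → ℝ≥0∞} {M : ℝ≥0∞} (hw : ∀ i, w i ≤ M)
    {E κ : ℕ → ℕ → ℝ≥0∞} {T ε : ℝ≥0∞} (near : ℕ × ℕ → Prop) [DecidablePred near]
    (h1 : ∀ i ∈ A, ∀ j ∈ A', i ≠ j → E i j ≤ κ i j + ε)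
    (h2 : ∀ i ∈ A, ∀ j ∈ A', i ≠ j → ¬ near (i, j) → κ i j ≤ T) :
    ∑ i ∈ A, ∑ j ∈ A', w i * w j * E i j
      ≤ ∑ i ∈ A, ∑ j ∈ A', w i * w j * min (κ i j) T
        + M * M * ∑ p ∈ A ×ˢ A' with (p.1 ≠ p.2 ∧ near p), κ p.1 p.2
        + M * M * (A.card * A'.card * ε)
        + M * M * ∑ i ∈ A, if i ∈ A' then E i i else 0 := by
  have hpt : ∀ i ∈ A, ∀ j ∈ A', w i * w j * E i j ≤ w i * w j * min (κ i j) T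
      + M * M * (if i ≠ j ∧ near (i, j) then κ i j else 0) + M * M * ε
      + M * M * (if i = j then E i i else 0) := by
    intro i hi j hj
    have hww : w i * w j ≤ M * M := mul_le_mul' (hw i) (hw j)
    by_cases hij : i = j
    · subst hij
      rw [if_pos rfl]
      refine le_trans ?_ le_add_self
      gcongr
    · rw [if_neg hij, mul_zero, add_zero]
      have h3 : κ i j ≤ min (κ i j) T + if i ≠ j ∧ near (i, j) then κ i j else 0 := by
        by_cases hn : near (i, j)
        · rw [if_pos ⟨hij, hn⟩]
          exact le_add_self
        · rw [min_eq_left (h2 i hi j hj hij hn)]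
          exact le_self_add
      calc _ ≤ w i * w j * (min (κ i j) T + (if i ≠ j ∧ near (i, j) then κ i j else 0) + ε) := by
            gcongr
            exact (h1 i hi j hj hij).trans (by gcongr)
        _ = w i * w j * min (κ i j) T + w i * w j * (if i ≠ j ∧ near (i, j) then κ i j else 0)
            + w i * w j * ε := by ring
        _ ≤ _ := by gcongr
  refine (Finset.sum_le_sum fun i hi => Finset.sum_le_sum fun j hj => hpt i hi j hj).trans ?_
  simp only [Finset.sum_add_distrib, ← Finset.mul_sum]
  refine le_of_eq ?_
  congr 1
  · congr 1
    · congr 2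
      rw [Finset.sum_filter, Finset.sum_product]
    · simp only [Finset.sum_const, nsmul_eq_mul]
      ring
  · congr 1
    refine Finset.sum_congr rfl fun i _ => ?_
    rw [Finset.sum_ite_eq]

/-- The part with indices in `A_N` of the approximating measure: small intervals around the centers,
weighted by a density `g`. -/
def blockSum (c l : ℕ → ℝ) (g : ℝ → ℝ≥0) (N : ℕ) : Measure ℝ :=
  ∑ i ∈ block N, ((N : ℝ≥0∞)⁻¹ * g (c i)) • uniformInterval (c i) (l i / 2)

/-- The average of the measures `blockSum` over the blocks `A_n, A_{2n}, …, A_{2^q n}`. -/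
def multiBlockSum (c l : ℕ → ℝ) (g : ℝ → ℝ≥0) (n q : ℕ) : Measure ℝ :=
  ∑ s ∈ Finset.range (q + 1), ((q + 1 : ℕ) : ℝ≥0∞)⁻¹ • blockSum c l g (2 ^ s * n)

instance (c ℓ : ℝ) : SFinite (uniformInterval c ℓ) := by
  unfold uniformInterval; infer_instance

instance (c l : ℕ → ℝ) (g : ℝ → ℝ≥0) (N : ℕ) : SFinite (blockSum c l g N) := by
  unfold blockSum
  exact Finset.sum_induction _ (fun μ : Measure ℝ => SFinite μ) (fun _ _ _ _ => inferInstance)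
    inferInstance fun _ _ => inferInstance

lemma blockSum_univ {c l : ℕ → ℝ} (hl : ∀ k, 0 < l k) (g : ℝ → ℝ≥0) (N : ℕ) :
    blockSum c l g N univ = (N : ℝ≥0∞)⁻¹ * ∑ k ∈ block N, (g (c k) : ℝ≥0∞) := by
  have : ∀ i, IsProbabilityMeasure (uniformInterval (c i) (l i / 2)) := fun i =>
    isProbabilityMeasure_uniformInterval (c i) (half_pos (hl i))
  simp [blockSum, Finset.mul_sum]

lemma posEnergy_blockSum (c l : ℕ → ℝ) (g : ℝ → ℝ≥0) (N N' : ℕ) :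
    posEnergy (blockSum c l g N) (blockSum c l g N') = (N : ℝ≥0∞)⁻¹ * (N' : ℝ≥0∞)⁻¹ *
      ∑ i ∈ block N, ∑ j ∈ block N', (g (c i) : ℝ≥0∞) * g (c j) *
        posEnergy (uniformInterval (c i) (l i / 2)) (uniformInterval (c j) (l j / 2)) := by
  rw [blockSum, blockSum, posEnergy_sum _ _ _ _ fun i => inferInstance]
  simp_rw [posEnergy_smul, Finset.mul_sum]
  refine Finset.sum_congr rfl fun i _ => Finset.sum_congr rfl fun j _ => ?_
  ring

/-- Only `q + 1` of the `(q + 1) ^ 2` pairs of blocks are diagonal, so averaging divides `D` by `q +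
1`. -/
lemma posEnergy_multiBlockSum_le {c l : ℕ → ℝ} {g : ℝ → ℝ≥0} {n q : ℕ} {X D : ℝ≥0∞}
    (h : ∀ s ≤ q, ∀ t ≤ q, posEnergy (blockSum c l g (2 ^ s * n)) (blockSum c l g (2 ^ t * n))
      ≤ X + if s = t then D else 0) :
    posEnergy (multiBlockSum c l g n q) (multiBlockSum c l g n q)
      ≤ X + ((q + 1 : ℕ) : ℝ≥0∞)⁻¹ * D := by
  have h0 : ((q + 1 : ℕ) : ℝ≥0∞) ≠ 0 := by simp
  have hi : ((q + 1 : ℕ) : ℝ≥0∞)⁻¹ * ((q + 1 : ℕ) : ℝ≥0∞) = 1 :=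
    ENNReal.inv_mul_cancel h0 (ENNReal.natCast_ne_top _)
  rw [multiBlockSum, posEnergy_sum _ _ _ _ fun s => inferInstance]
  simp_rw [posEnergy_smul, ← Finset.mul_sum]
  calc _ ≤ ((q + 1 : ℕ) : ℝ≥0∞)⁻¹ * ((q + 1 : ℕ) : ℝ≥0∞)⁻¹ *
        ∑ s ∈ Finset.range (q + 1), ∑ t ∈ Finset.range (q + 1), (X + if s = t then D else 0) := by
        gcongr with s hs t ht
        exact h s (by simpa [Nat.lt_succ_iff] using hs) t (by simpa [Nat.lt_succ_iff] using ht)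
    _ = ((q + 1 : ℕ) : ℝ≥0∞)⁻¹ * ((q + 1 : ℕ) : ℝ≥0∞)⁻¹ *
        (((q + 1 : ℕ) : ℝ≥0∞) * ((q + 1 : ℕ) : ℝ≥0∞) * X + ((q + 1 : ℕ) : ℝ≥0∞) * D) := by
        congr 1
        simp only [Finset.sum_add_distrib, Finset.sum_const, Finset.card_range, nsmul_eq_mul,
          Finset.sum_ite_eq]
        rw [← Finset.sum_filter, Finset.filter_true_of_mem fun s hs => hs]
        simp [mul_assoc]
    _ = (((q + 1 : ℕ) : ℝ≥0∞)⁻¹ * ((q + 1 : ℕ) : ℝ≥0∞)) * (((q + 1 : ℕ) : ℝ≥0∞)⁻¹ *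
        ((q + 1 : ℕ) : ℝ≥0∞)) * X + (((q + 1 : ℕ) : ℝ≥0∞)⁻¹ * ((q + 1 : ℕ) : ℝ≥0∞)) *
          (((q + 1 : ℕ) : ℝ≥0∞)⁻¹ * D) := by ring
    _ = _ := by rw [hi]; simp


/-! ### Energy and mass of the block sums under the spacing and gap conditions -/

lemma disjoint_block_two_pow {n s t : ℕ} (h : s ≠ t) :
    Disjoint (block (2 ^ s * n)) (block (2 ^ t * n)) := by
  wlog hst : s < t generalizing s t
  · exact (this h.symm (lt_of_le_of_ne (not_lt.1 hst) h.symm)).symm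
  refine Finset.disjoint_left.2 fun i hi hj => ?_
  simp only [block, Finset.mem_Ico] at hi hj
  have h1 : 2 ^ (s + 1) ≤ 2 ^ t := Nat.pow_le_pow_right (by norm_num) hst
  have h2 := Nat.mul_le_mul_right n h1
  rw [pow_succ] at h2
  have h3 : 2 * (2 ^ s * n) = 2 ^ s * 2 * n := by ring
  omega

/-- Centers in `(0, 1)` make all summands nonnegative, and distinctness excludes the convention
`Real.log 0 = 0`; hence the real average agrees with the extended one. -/
lemma sum_posLog_near_le {c : ℕ → ℝ} (hc : ∀ k, c k ∈ Ioo (0 : ℝ) 1) {N N' : ℕ} (hN : N ≠ 0)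
    (hN' : N' ≠ 0) (hne : ∀ i ∈ block N, ∀ j ∈ block N', i ≠ j → c i ≠ c j) {δ ε : ℝ}
    (h : (∑ p ∈ (block N ×ˢ block N') with (p.1 ≠ p.2 ∧ |c p.1 - c p.2| < δ),
        -Real.log |c p.1 - c p.2|) / ((block N ×ˢ block N').card : ℝ) < ε) :
    (N : ℝ≥0∞)⁻¹ * (N' : ℝ≥0∞)⁻¹ *
      ∑ p ∈ (block N ×ˢ block N') with (p.1 ≠ p.2 ∧ |c p.1 - c p.2| < δ), posLog (c p.1) (c p.2)
      ≤ ENNReal.ofReal ε := by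
  have hsum : ∑ p ∈ (block N ×ˢ block N') with (p.1 ≠ p.2 ∧ |c p.1 - c p.2| < δ),
      posLog (c p.1) (c p.2) = ENNReal.ofReal (∑ p ∈ (block N ×ˢ block N') with
        (p.1 ≠ p.2 ∧ |c p.1 - c p.2| < δ), -Real.log |c p.1 - c p.2|) := by
    rw [ENNReal.ofReal_sum_of_nonneg]
    · refine Finset.sum_congr rfl fun p hp => ?_
      obtain ⟨hp1, hp2, -⟩ := Finset.mem_filter.1 hp
      obtain ⟨hp3, hp4⟩ := Finset.mem_product.1 hp1
      exact posLog_of_ne (hne _ hp3 _ hp4 hp2)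
    · intro p _
      refine neg_nonneg.2 (Real.log_nonpos (abs_nonneg _) (abs_le.2 ⟨?_, ?_⟩)) <;>
        linarith [(hc p.1).1, (hc p.1).2, (hc p.2).1, (hc p.2).2]
  have hNpos : (0 : ℝ) < N := by exact_mod_cast Nat.pos_of_ne_zero hN
  have hNpos' : (0 : ℝ) < N' := by exact_mod_cast Nat.pos_of_ne_zero hN'
  rw [hsum, ← ENNReal.ofReal_natCast N, ← ENNReal.ofReal_natCast N', ← ENNReal.ofReal_inv_of_pos hNpos,
    ← ENNReal.ofReal_inv_of_pos hNpos', ← ENNReal.ofReal_mul (by positivity),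
    ← ENNReal.ofReal_mul (by positivity)]
  refine ENNReal.ofReal_le_ofReal (le_trans (le_of_eq ?_) h.le)
  rw [Finset.card_product, card_block, card_block]
  push_cast
  field_simp

/-- Each self-energy is at most `lam * i + log 2 + 2` with `i ≤ 2 * N`, hence at most `N * (2 * lam
+ 3)`. The linear growth of the exponent is exactly what keeps the normalised sum bounded. -/
lemma sum_self_energy_le (c : ℕ → ℝ) {lam : ℝ} (hlam : 0 < lam) {N : ℕ} (hN : N ≠ 0) :
    (N : ℝ≥0∞)⁻¹ * (N : ℝ≥0∞)⁻¹ * ∑ i ∈ block N,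
        posEnergy (uniformInterval (c i) (Real.exp (-lam * i) / 2))
          (uniformInterval (c i) (Real.exp (-lam * i) / 2))
      ≤ ENNReal.ofReal (2 * lam + 3) := by
  have hNpos : (1 : ℝ) ≤ N := by exact_mod_cast Nat.one_le_iff_ne_zero.2 hN
  have hN0 : (N : ℝ≥0∞) ≠ 0 := by exact_mod_cast hN
  have hi : (N : ℝ≥0∞)⁻¹ * (N : ℝ≥0∞) = 1 := ENNReal.inv_mul_cancel hN0 (ENNReal.natCast_ne_top _)
  have hb : ∀ i ∈ block N, posEnergy (uniformInterval (c i) (Real.exp (-lam * i) / 2))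
      (uniformInterval (c i) (Real.exp (-lam * i) / 2))
        ≤ (N : ℝ≥0∞) * ENNReal.ofReal (2 * lam + 3) := by
    intro i hi
    have hi2 : (i : ℝ) ≤ 2 * N := by
      have : i ≤ 2 * N := (Finset.mem_Ico.1 hi).2.le
      exact_mod_cast this
    refine (posEnergy_uniformInterval_self_le _ (by positivity) ?_).trans ?_
    · have : Real.exp (-lam * i) ≤ 1 := Real.exp_le_one_iff.2 (by
        have : 0 ≤ lam * i := by positivity
        linarith)
      linarith
    · rw [← ENNReal.ofReal_natCast N, ← ENNReal.ofReal_mul (by positivity),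
        Real.log_div (Real.exp_pos _).ne' (by norm_num), Real.log_exp]
      refine ENNReal.ofReal_le_ofReal ?_
      have := Real.log_two_lt_d9
      nlinarith
  calc _ ≤ (N : ℝ≥0∞)⁻¹ * (N : ℝ≥0∞)⁻¹ * ∑ i ∈ block N, (N : ℝ≥0∞) * ENNReal.ofReal (2 * lam + 3) := by
        gcongr with i hi
        exact hb i hi
    _ = ((N : ℝ≥0∞)⁻¹ * (N : ℝ≥0∞)) * ((N : ℝ≥0∞)⁻¹ * (N : ℝ≥0∞)) * ENNReal.ofReal (2 * lam + 3) := by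
        rw [Finset.sum_const, card_block, nsmul_eq_mul]
        ring
    _ = _ := by rw [hi]; simp

/-- The four terms are the truncated energy, the pairs closer than `δ`, the cost of replacing points
by intervals, and the self-energies. The truncation level `-log δ` is chosen so that pairs at
distance at least `δ` are unaffected by it. -/
lemma posEnergy_blockSum_le {c : ℕ → ℝ} (hc : ∀ k, c k ∈ Ioo (0 : ℝ) 1) {lam : ℝ} (hlam : 0 < lam)
    {g : ℝ → ℝ≥0} {M : ℝ≥0} (hg : ∀ x, g x ≤ M) {N N' : ℕ} (hN : N ≠ 0) (hN' : N' ≠ 0)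
    (hdisj : N ≠ N' → Disjoint (block N) (block N')) {δ ε ε' : ℝ} (hδ : 0 < δ) (hε' : 0 ≤ ε')
    (hε'2 : ε' ≤ 1 / 2) {G : ℝ≥0∞}
    (hgap : ∀ i ∈ block N, ∀ j ∈ block N', i ≠ j → c i ≠ c j ∧
      (Real.exp (-lam * i) + Real.exp (-lam * j)) / (2 * |c i - c j|) < ε')
    (hnear : (∑ p ∈ (block N ×ˢ block N') with (p.1 ≠ p.2 ∧ |c p.1 - c p.2| < δ),
        -Real.log |c p.1 - c p.2|) / ((block N ×ˢ block N').card : ℝ) < ε)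
    (hG : (N : ℝ≥0∞)⁻¹ * (N' : ℝ≥0∞)⁻¹ * ∑ i ∈ block N, ∑ j ∈ block N', (g (c i) : ℝ≥0∞) * g (c j) *
      min (posLog (c i) (c j)) (-Real.log δ).toNNReal ≤ G) :
    posEnergy (blockSum c (fun k => Real.exp (-lam * k)) g N)
        (blockSum c (fun k => Real.exp (-lam * k)) g N')
      ≤ (G + M * M * ENNReal.ofReal ε + M * M * ENNReal.ofReal (2 * ε'))
        + if N = N' then (M * M * ENNReal.ofReal (2 * lam + 3) : ℝ≥0∞) else 0 := by
  have hN0 : (N : ℝ≥0∞) ≠ 0 := by exact_mod_cast hN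
  have hN0' : (N' : ℝ≥0∞) ≠ 0 := by exact_mod_cast hN'
  have hi : (N : ℝ≥0∞)⁻¹ * (N : ℝ≥0∞) = 1 := ENNReal.inv_mul_cancel hN0 (ENNReal.natCast_ne_top _)
  have hi' : (N' : ℝ≥0∞)⁻¹ * (N' : ℝ≥0∞) = 1 :=
    ENNReal.inv_mul_cancel hN0' (ENNReal.natCast_ne_top _)
  rw [posEnergy_blockSum]
  have hmain := sum_weighted_le (block N) (block N') (w := fun i => (g (c i) : ℝ≥0∞)) (M := M)
    (fun i => ENNReal.coe_le_coe.2 (hg _))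
    (E := fun i j => posEnergy (uniformInterval (c i) (Real.exp (-lam * i) / 2))
      (uniformInterval (c j) (Real.exp (-lam * j) / 2)))
    (κ := fun i j => posLog (c i) (c j)) (T := ((-Real.log δ).toNNReal : ℝ≥0∞))
    (ε := ENNReal.ofReal (2 * ε')) (fun p => |c p.1 - c p.2| < δ)
    (fun i hi j hj hij => by
      obtain ⟨h1, h2⟩ := hgap i hi j hj hij
      have hd : 0 < |c i - c j| := abs_pos.2 (sub_ne_zero.2 h1)
      rw [div_lt_iff₀ (by positivity)] at h2
      exact posEnergy_uniformInterval_le (by positivity) (by positivity) hε' hε'2 h1 (by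
        have := Real.exp_pos (-lam * i)
        have := Real.exp_pos (-lam * j)
        linarith))
    (fun i hi j hj hij hn => posLog_le hδ (not_lt.1 hn))
  refine (mul_le_mul' le_rfl hmain).trans ?_
  rw [mul_add, mul_add, mul_add]
  refine add_le_add (add_le_add (add_le_add hG ?_) (le_of_eq ?_)) ?_
  · rw [mul_left_comm]
    refine mul_le_mul' le_rfl (sum_posLog_near_le hc hN hN' (fun i hi j hj hij =>
      (hgap i hi j hj hij).1) hnear)
  · rw [card_block, card_block]
    calc _ = (M * M : ℝ≥0∞) * (((N : ℝ≥0∞)⁻¹ * (N : ℝ≥0∞)) * ((N' : ℝ≥0∞)⁻¹ * (N' : ℝ≥0∞)))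
          * ENNReal.ofReal (2 * ε') := by ring
      _ = _ := by rw [hi, hi', one_mul, mul_one]
  · split_ifs with h
    · subst h
      rw [mul_left_comm]
      refine mul_le_mul' le_rfl (le_trans (le_of_eq ?_) (sum_self_energy_le c hlam hN))
      congr 1
      exact Finset.sum_congr rfl fun i hi => if_pos hi
    · rw [Finset.sum_eq_zero]
      · simp
      · exact fun i hi => if_neg (Finset.disjoint_left.1 (hdisj h) hi)

lemma multiBlockSum_univ_ge {c l : ℕ → ℝ} (hl : ∀ k, 0 < l k) {g : ℝ → ℝ≥0} {n q : ℕ} {r : ℝ≥0∞}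
    (h : ∀ s, r ≤ ((2 ^ s * n : ℕ) : ℝ≥0∞)⁻¹ * ∑ k ∈ block (2 ^ s * n), (g (c k) : ℝ≥0∞)) :
    r ≤ multiBlockSum c l g n q univ := by
  have h0 : ((q + 1 : ℕ) : ℝ≥0∞) ≠ 0 := by simp
  have hi : ((q + 1 : ℕ) : ℝ≥0∞)⁻¹ * ((q + 1 : ℕ) : ℝ≥0∞) = 1 :=
    ENNReal.inv_mul_cancel h0 (ENNReal.natCast_ne_top _)
  calc r = ((q + 1 : ℕ) : ℝ≥0∞)⁻¹ * ∑ s ∈ Finset.range (q + 1), r := by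
        rw [Finset.sum_const, Finset.card_range, nsmul_eq_mul, ← mul_assoc, hi, one_mul]
    _ ≤ ((q + 1 : ℕ) : ℝ≥0∞)⁻¹ * ∑ s ∈ Finset.range (q + 1), blockSum c l g (2 ^ s * n) univ := by
        gcongr with s hs
        rw [blockSum_univ hl]
        exact h s
    _ = _ := by
        simp [multiBlockSum, Finset.mul_sum]

lemma multiBlockSum_univ_ne_top {c l : ℕ → ℝ} (hl : ∀ k, 0 < l k) {g : ℝ → ℝ≥0} {n q : ℕ}
    (hn : n ≠ 0) : multiBlockSum c l g n q univ ≠ ⊤ := by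
  simp only [multiBlockSum, Measure.coe_finsetSum, Finset.sum_apply, Measure.smul_apply,
    blockSum_univ hl, smul_eq_mul]
  refine ENNReal.sum_ne_top.2 fun s _ => ENNReal.mul_ne_top (by simp) (ENNReal.mul_ne_top ?_ ?_)
  · simp [hn]
  · exact ENNReal.sum_ne_top.2 fun k _ => ENNReal.coe_ne_top

lemma multiBlockSum_eq_zero {c l : ℕ → ℝ} {g : ℝ → ℝ≥0} {n q : ℕ} {A : Set ℝ}
    (h : ∀ i ∈ multiBlock n q, g (c i) = 0 ∨ uniformInterval (c i) (l i / 2) A = 0) :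
    multiBlockSum c l g n q A = 0 := by
  simp only [multiBlockSum, blockSum, Measure.coe_finsetSum, Finset.sum_apply, Measure.smul_apply,
    smul_eq_mul]
  refine Finset.sum_eq_zero fun s hs => mul_eq_zero_of_right _ (Finset.sum_eq_zero fun i hi => ?_)
  rcases h i (Finset.mem_biUnion.2 ⟨s, hs, hi⟩) with h | h <;> simp [h]


/-! ### The inductive step and the construction of the limit measure -/

/-- Normalising a measure of mass at least `r` multiplies its energy by at most `r⁻²`; for `r` close
enough to 1 the slack below `B` absorbs this factor. -/
lemma exists_lt_one_lt_mul_sq {E B : ℝ≥0∞} (hB : B ≠ ⊤) (h : E < B) :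
    ∃ r : ℝ≥0∞, r < 1 ∧ r ≠ 0 ∧ E < B * (r * r) := by
  have hcont : Continuous fun x : ℝ => B * ENNReal.ofReal (x * x) :=
    (ENNReal.continuous_const_mul hB).comp (ENNReal.continuous_ofReal.comp (by fun_prop))
  have h1 : Tendsto (fun x : ℝ => B * ENNReal.ofReal (x * x)) (𝓝[<] 1) (𝓝 B) := by
    have := (hcont.tendsto 1).mono_left (nhdsWithin_le_nhds (s := Iio 1))
    simpa using this
  obtain ⟨x, hx, hx1, hx0⟩ := ((h1.eventually (lt_mem_nhds h)).and
    ((eventually_mem_nhdsWithin).and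
      (eventually_nhdsWithin_of_eventually_nhds (lt_mem_nhds zero_lt_one)))).exists
  refine ⟨ENNReal.ofReal x, ?_, ?_, ?_⟩
  · rw [← ENNReal.ofReal_one]
    exact ENNReal.ofReal_lt_ofReal_iff_of_nonneg (le_of_lt hx0) |>.2 hx1
  · simpa using hx0
  · rwa [← ENNReal.ofReal_mul (le_of_lt hx0)]

/-- The order of choices matters: `r` fixes the density bound `M`, then `M` fixes `ε`, log-average
spacing gives `δ`, and only then is the continuous density chosen for the truncation level `-log δ`.
The index `n` comes last. -/
lemma exists_next_measure {c : ℕ → ℝ} (hc : ∀ k, c k ∈ Ioo (0 : ℝ) 1) {lam : ℝ} (hlam : 0 < lam)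
    {q : ℕ → ℕ} (hq : Tendsto q atTop atTop) (hA2 : LogAverageSpacing c q)
    (hA3 : GapControl c (fun k => Real.exp (-lam * (k : ℝ))) q) {P : ProbabilityMeasure ℝ}
    (hP : Tendsto (blockProb c) atTop (𝓝 P)) {U : Set ℝ} (hU : IsOpen U) {ν : Measure ℝ}
    [IsProbabilityMeasure ν] (hνP : ν ≪ (P : Measure ℝ)) (hνU : ν Uᶜ = 0) {B : ℝ≥0∞} (hB : B ≠ ⊤)
    (hνB : posEnergy ν ν < B) (m : ℕ) :
    ∃ U' : Set ℝ, IsOpen U' ∧ closure U' ⊆ U ∩ ⋃ k ≥ m, Ioo (c k - Real.exp (-lam * (k : ℝ)) / 2)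
        (c k + Real.exp (-lam * (k : ℝ)) / 2) ∧
      ∃ ν' : Measure ℝ, IsProbabilityMeasure ν' ∧ ν' ≪ volume ∧ ν' U'ᶜ = 0 ∧
        posEnergy ν' ν' < B := by
  set l : ℕ → ℝ := fun k => Real.exp (-lam * (k : ℝ)) with hl
  have hl0 : ∀ k, 0 < l k := fun k => Real.exp_pos _
  have hllim : Tendsto l atTop (𝓝 0) := by
    simpa only [Real.rpow_one] using tendsto_exp_neg_mul_rpow hlam one_pos
  obtain ⟨r, hr1, hr0, hrB⟩ := exists_lt_one_lt_mul_sq hB hνB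
  obtain ⟨κ, hκ0, hκ⟩ := ENNReal.lt_iff_exists_add_pos_lt.1 hrB
  obtain ⟨M, hM⟩ := exists_continuous_density_energy hνP hU hνU hr1
  -- Five errors share the slack: density approximation, weak convergence, close pairs, intervals in
  -- place of points, and self-energies.
  set κ' : ℝ≥0 := κ / 5 with hκ'
  have hκ'0 : 0 < κ' := by positivity
  set ε : ℝ≥0 := κ' / (M * M + 1) with hε
  have hε0 : 0 < ε := by positivity
  have hMε : (M * M : ℝ≥0∞) * ENNReal.ofReal ε ≤ κ' := by
    rw [ENNReal.ofReal_coe_nnreal]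
    have : M * M * ε ≤ κ' := by
      calc M * M * ε ≤ (M * M + 1) * (κ' / (M * M + 1)) := by gcongr; exact le_self_add
        _ = κ' := mul_div_cancel₀ _ (by positivity)
    exact_mod_cast this
  set ε' : ℝ := min (ε / 2) (1 / 2) with hε'
  have hε'0 : 0 < ε' := lt_min (by positivity) (by norm_num)
  have hMε' : (M * M : ℝ≥0∞) * ENNReal.ofReal (2 * ε') ≤ κ' := by
    refine le_trans ?_ hMε
    gcongr
    linarith [min_le_left ((ε : ℝ) / 2) (1 / 2)]
  obtain ⟨δ, hδ, hnear⟩ := hA2 ε hε0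
  obtain ⟨g, K, hK, hKU, hgM, hgK, hgr, hgE⟩ := hM (-Real.log δ).toNNReal κ' hκ'0.ne'
  have hgE' : ∫⁻ y, ∫⁻ x, (g x : ℝ≥0∞) * g y * min (posLog x y) (-Real.log δ).toNNReal
      ∂(P : Measure ℝ) ∂(P : Measure ℝ) < posEnergy ν ν + κ' + κ' := by
    refine hgE.trans_lt (ENNReal.lt_add_right ?_ (by exact_mod_cast hκ'0.ne'))
    exact ENNReal.add_ne_top.2 ⟨hνB.ne_top, ENNReal.coe_ne_top⟩
  -- Centers with `g (c i) ≠ 0` lie in `K`, so the closed intervals around them stay in `U` once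
  -- their lengths are below `ρ`.
  obtain ⟨ρ, hρ, hρU⟩ := hK.exists_cthickening_subset_open hU hKU
  set D : ℝ≥0∞ := M * M * ENNReal.ofReal (2 * lam + 3) with hD
  have hDtop : D ≠ ⊤ := by
    rw [hD]; finiteness
  have hDlim : ∀ᶠ n in atTop, ((q n + 1 : ℕ) : ℝ≥0∞)⁻¹ * D < κ' := by
    have h1 : Tendsto (fun n => ((q n + 1 : ℕ) : ℝ≥0∞)⁻¹ * D) atTop (𝓝 (0 * D)) :=
      ENNReal.Tendsto.mul_const (ENNReal.tendsto_inv_nat_nhds_zero.comp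
        ((tendsto_add_atTop_nat 1).comp hq)) (Or.inr hDtop)
    rw [zero_mul] at h1
    exact h1.eventually (gt_mem_nhds (by exact_mod_cast hκ'0))
  obtain ⟨n₀, hn₀⟩ := (hllim.eventually (gt_mem_nhds hρ)).exists_forall_of_atTop
  obtain ⟨n, hnnear, hngap, hnmass, hnG, hnD, hn⟩ := (hnear.and ((hA3 ε' hε'0).and
    ((eventually_lt_blockAverage hP g hgr).and
    ((eventually_doubleBlockAverage_lt hP g _ hgE').and
    (hDlim.and (eventually_ge_atTop (max (max m n₀) 1))))))).exists
  have hge : ∀ s, n ≤ 2 ^ s * n := fun s => Nat.le_mul_of_pos_left n (by positivity)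
  have hne : ∀ s, 2 ^ s * n ≠ 0 := fun s => by have := hge s; omega
  have hmem : ∀ s ≤ q n, ∀ i ∈ block (2 ^ s * n), i ∈ multiBlock n (q n) := fun s hs i hi =>
    Finset.mem_biUnion.2 ⟨s, Finset.mem_range.2 (by omega), hi⟩
  have hmemge : ∀ i ∈ multiBlock n (q n), n ≤ i := fun i hi => by
    obtain ⟨s, -, hs⟩ := Finset.mem_biUnion.1 hi
    exact (hge s).trans (Finset.mem_Ico.1 hs).1
  have henergy : posEnergy (multiBlockSum c l g n (q n)) (multiBlockSum c l g n (q n))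
      < B * (r * r) := by
    refine lt_of_le_of_lt ?_ hκ
    refine (posEnergy_multiBlockSum_le (X := posEnergy ν ν + κ' + κ' + κ' + κ') (D := D)
      fun s hs t ht => ?_).trans ?_
    · refine (posEnergy_blockSum_le hc hlam hgM (hne s) (hne t)
        (fun h => disjoint_block_two_pow fun hst => h (by rw [hst])) hδ hε'0.le (min_le_right _ _)
        (fun i hi j hj hij => hngap i (hmem s hs i hi) j (hmem t ht j hj) hij)
        (hnnear s hs t ht) (hnG _ (hge s) _ (hge t)).le).trans ?_
      have hif : (if 2 ^ s * n = 2 ^ t * n then D else 0) ≤ if s = t then D else 0 := by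
        by_cases hst : s = t
        · simp [hst]
        · rw [if_neg, if_neg hst]
          intro h
          exact hst (Nat.pow_right_injective le_rfl (Nat.eq_of_mul_eq_mul_right (by omega) h))
      exact add_le_add (add_le_add (add_le_add le_rfl hMε) hMε') hif
    · refine (add_le_add le_rfl hnD.le).trans (le_of_eq ?_)
      have : (κ : ℝ≥0∞) = κ' + κ' + κ' + κ' + κ' := by
        have : κ = κ' + κ' + κ' + κ' + κ' := by
          rw [hκ']; ext; push_cast; ring
        exact_mod_cast this
      rw [this]
      ring
  set Z : ℝ≥0∞ := multiBlockSum c l g n (q n) univ with hZ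
  have hZr : r ≤ Z := multiBlockSum_univ_ge hl0 fun s => (hnmass _ (hge s)).le
  have hZ0 : Z ≠ 0 := fun h => hr0 (le_antisymm (h ▸ hZr) bot_le)
  have hZtop : Z ≠ ⊤ := multiBlockSum_univ_ne_top hl0 (by omega)
  set S : Finset ℕ := {i ∈ multiBlock n (q n) | g (c i) ≠ 0} with hS
  have hfin : SFinite (multiBlockSum c l g n (q n)) :=
    have : IsFiniteMeasure (multiBlockSum c l g n (q n)) := ⟨hZtop.lt_top⟩
    inferInstance
  -- Intervals of half the length `l i` are used so that their closures still lie in the open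
  -- intervals of length `l i`.
  refine ⟨⋃ i ∈ S, Ioo (c i - l i / 2 / 2) (c i + l i / 2 / 2),
    isOpen_biUnion fun _ _ => isOpen_Ioo, ?_, Z⁻¹ • multiBlockSum c l g n (q n), ⟨?_⟩, ?_, ?_, ?_⟩
  · rw [Finset.closure_biUnion]
    refine iUnion₂_subset fun i hi x hx => ?_
    rw [closure_Ioo (by linarith [hl0 i])] at hx
    obtain ⟨hi1, hi2⟩ := Finset.mem_filter.1 hi
    have hin := hmemge i hi1
    refine ⟨hρU ?_, mem_iUnion₂.2 ⟨i, by omega, ?_, ?_⟩⟩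
    · refine Metric.mem_cthickening_of_dist_le x (c i) ρ K ?_ ?_
      · by_contra h
        exact hi2 (hgK _ h)
      · rw [Real.dist_eq]
        have := hn₀ i (by omega)
        exact abs_le.2 ⟨by linarith [hx.1, hl0 i], by linarith [hx.2, hl0 i]⟩
    · change c i - l i / 2 < x
      linarith [hx.1, hl0 i]
    · change x < c i + l i / 2
      linarith [hx.2, hl0 i]
  · rw [Measure.smul_apply, smul_eq_mul]
    exact ENNReal.inv_mul_cancel hZ0 hZtop
  · refine Measure.AbsolutelyContinuous.smul_left ?_ _
    refine Measure.AbsolutelyContinuous.mk fun A _ hA => ?_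
    exact multiBlockSum_eq_zero fun i _ => Or.inr (uniformInterval_absolutelyContinuous _ _ hA)
  · rw [Measure.smul_apply, smul_eq_mul]
    refine mul_eq_zero_of_right _ (multiBlockSum_eq_zero fun i hi => ?_)
    by_cases hgi : g (c i) = 0
    · exact Or.inl hgi
    · refine Or.inr (measure_mono_null (compl_subset_compl.2 ?_) (uniformInterval_compl _ _))
      exact subset_biUnion_of_mem (u := fun i => Ioo (c i - l i / 2 / 2) (c i + l i / 2 / 2))
        (Finset.mem_coe.2 (Finset.mem_filter.2 ⟨hi, hgi⟩))
  · rw [posEnergy_smul]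
    have hZi : Z⁻¹ * Z = 1 := ENNReal.inv_mul_cancel hZ0 hZtop
    have hZi0 : Z⁻¹ * Z⁻¹ ≠ 0 := mul_ne_zero (ENNReal.inv_ne_zero.2 hZtop) (ENNReal.inv_ne_zero.2 hZtop)
    have hZit : Z⁻¹ * Z⁻¹ ≠ ⊤ := ENNReal.mul_ne_top (ENNReal.inv_ne_top.2 hZ0) (ENNReal.inv_ne_top.2 hZ0)
    calc _ < Z⁻¹ * Z⁻¹ * (B * (r * r)) := (ENNReal.mul_lt_mul_iff_right hZi0 hZit).2 henergy
      _ ≤ Z⁻¹ * Z⁻¹ * (B * (Z * Z)) := by gcongr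
      _ = (Z⁻¹ * Z) * (Z⁻¹ * Z) * B := by ring
      _ = B := by rw [hZi]; simp

lemma exists_measure_on_limsupIntervals {c : ℕ → ℝ} (hc : ∀ k, c k ∈ Ioo (0 : ℝ) 1) {lam : ℝ}
    (hlam : 0 < lam) (hA1 : CentersDistributed c) {q : ℕ → ℕ} (hq : Tendsto q atTop atTop)
    (hA2 : LogAverageSpacing c q) (hA3 : GapControl c (fun k => Real.exp (-lam * (k : ℝ))) q)
    (ν : Measure ℝ) [IsProbabilityMeasure ν] (hν : ν (Icc 0 1)ᶜ = 0) {B : ℝ≥0∞} (hB : B ≠ ⊤)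
    (hνB : posEnergy ν ν < B) :
    ∃ K ⊆ limsupIntervals c fun k => Real.exp (-lam * (k : ℝ)), IsCompact K ∧
      ∃ μ : Measure ℝ, IsProbabilityMeasure μ ∧ μ Kᶜ = 0 ∧ posEnergy μ μ ≤ B := by
  obtain ⟨P, hPac, hP⟩ := exists_tendsto_blockMeasure hA1
  obtain ⟨ν₀, hν₀, hν₀ac, hν₀U, hν₀B⟩ := exists_ac_posEnergy_lt ν hν hνB
  set V : ℕ → Set ℝ := fun m => ⋃ k ≥ m, Ioo (c k - Real.exp (-lam * (k : ℝ)) / 2)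
    (c k + Real.exp (-lam * (k : ℝ)) / 2) with hV
  let State := {p : Set ℝ × Measure ℝ // IsOpen p.1 ∧ p.1 ⊆ Icc 0 1 ∧ IsProbabilityMeasure p.2 ∧
    p.2 ≪ volume ∧ p.2 p.1ᶜ = 0 ∧ posEnergy p.2 p.2 < B}
  have hstep : ∀ (m : ℕ) (p : State), ∃ p' : State, closure p'.1.1 ⊆ p.1.1 ∩ V m := by
    rintro m ⟨⟨U, ν⟩, hU, hU1, hprob, hac, hνU, hνB⟩
    -- `P` dominates Lebesgue measure only on `[0, 1]`, so `ν` is first identified with its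
    -- restriction to that interval.
    have hac' : ν ≪ (P : Measure ℝ) := by
      have h1 : ν.restrict (Icc 0 1) = ν :=
        Measure.restrict_eq_self_of_ae_mem (measure_mono_null (compl_subset_compl.2 hU1) hνU)
      rw [← h1]
      exact (hac.restrict _).trans hPac
    obtain ⟨U', hU', hcl, ν', hprob', hac', hνU', hνB'⟩ :=
      exists_next_measure hc hlam hq hA2 hA3 hP hU hac' hνU hB hνB m
    exact ⟨⟨⟨U', ν'⟩, hU', subset_closure.trans (hcl.trans (inter_subset_left.trans hU1)), hprob',
      hac', hνU', hνB'⟩, hcl⟩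
  choose next hnext using hstep
  let seq : ℕ → State := fun n => Nat.rec
    ⟨⟨Ioo 0 1, ν₀⟩, isOpen_Ioo, Ioo_subset_Icc_self, hν₀, hν₀ac, hν₀U, hν₀B⟩ (fun m p => next m p) n
  obtain ⟨K, hKV, hK, μ, hμ, hμK, hμB⟩ := exists_limit_measure (B := B)
    (U := fun j => (seq j).1.1) (V := V) (ν := fun j => (seq j).1.2) (seq 0).2.2.1
    (fun j => hnext j (seq j)) (fun j => (seq j).2.2.2.1) (fun j => (seq j).2.2.2.2.2.1)
    (fun j => (seq j).2.2.2.2.2.2.le)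
  exact ⟨K, hKV, hK, μ, hμ, hμK, hμB⟩

end

theorem mainTheorem4 (c : ℕ → ℝ) (hc : ∀ k, c k ∈ Set.Ioo (0 : ℝ) 1) (lam : ℝ) (hlam : 0 < lam)
    (hA1 : CentersDistributed c)
    (hA23 : ∃ q : ℕ → ℕ, Filter.Tendsto q Filter.atTop Filter.atTop ∧ LogAverageSpacing c q ∧
      GapControl c (fun k => Real.exp (-lam * (k : ℝ))) q) :
    (∀ α : ℝ, 0 < α → α ≤ 1 →
      realCapacity (limsupIntervals c fun k => Real.exp (-lam * (k : ℝ) ^ α))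
          = realCapacity (Set.Icc 0 1) ∧
        0 < realCapacity (Set.Icc 0 1)) ∧
    (∀ α : ℝ, 1 < α →
      realCapacity (limsupIntervals c fun k => Real.exp (-lam * (k : ℝ) ^ α)) = 0) := by
  obtain ⟨q, hq, hA2, hA3⟩ := hA23
  refine ⟨fun α hα hα1 => ⟨?_, realCapacity_Icc_pos⟩, fun α hα =>
    realCapacity_limsupIntervals_eq_zero hc hlam hα⟩
  have hsub := limsupIntervals_subset_Icc hc (tendsto_exp_neg_mul_rpow hlam hα)
  refine le_antisymm (logCapacity_mono (image_mono hsub))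
    (realCapacity_le_of_energy subset_rfl hsub fun ν _ hν B hB hνB => ?_)
  obtain ⟨K, hK, h⟩ := exists_measure_on_limsupIntervals hc hlam hA1 hq hA2 hA3 ν hν hB hνB
  -- For `k ≥ 1` and `α ≤ 1` the intervals of exponent `α` contain those of exponent 1, so the
  -- compact set built for exponent 1 serves.
  refine ⟨K, hK.trans (limsupIntervals_mono fun k hk => ?_), h⟩
  have hk1 : (1 : ℝ) ≤ k := by exact_mod_cast hk
  refine Real.exp_le_exp.2 ?_
  have : (k : ℝ) ^ α ≤ k := by
    simpa using Real.rpow_le_rpow_of_exponent_le hk1 hα1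
  nlinarith
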